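/- Let $K$ be an algebraically closed field, let $n\ge 2$, and let $A=(A_1,\dots,A_n)$ be $3\times 4$ matrices of rank $3$ with entries in $K$ ("cameras"). The focal point of the $i$-th camera is the point $f_i\in\mathbb P^3$ with $\ker A_i=Kf_i$. The cameras are in linearly general position if the $f_i$ are pairwise distinct, no three of them are collinear, and no four of them are coplanar. Let $V_A\subset(\mathbb P^2)^n$ be the Zariski closure of the image of the rational map $\mathbb P^3\dashrightarrow(\mathbb P^2)^n$, $\mathbf x\mapsto(A_1\mathbf x,\dots,A_n\mathbf x)$, and let $J_A\subset K[x,y,z]=K[x_i,y_i,z_i : 1\le i\le n]$ be the ideal of all polynomials that vanish on $V_A$, where $(x_i:y_i:z_i)$ are the coordinates on the $i$-th factor $\mathbb P^2$. Give $K[x,y,z]$ the $\mathbb Z^n$-grading $\deg x_i=\deg y_i=\deg z_i=e_i$, and call a polynomial bilinear (trilinear) if it is homogeneous of degree $e_i+e_j$ with $i,j$ distinct (of degree $e_i+e_j+e_k$ with $i,j,k$ distinct). If the cameras are in linearly general position, then $J_A$ is minimally generated by $\binom n2$ bilinear and $\binom n3$ trilinear polynomials: there is a generating set of $J_A$ that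 consists of exactly $\binom n2$ bilinear and $\binom n3$ trilinear polynomials, such that no proper subset of it generates $J_A$, and such that no set with fewer elements generates $J_A$. -/

import Mathlib

open scoped LinearAlgebra.Projectivization

namespace Multiview

variable {K : Type*} [Field K] {n : ℕ}

/-- The coordinate ring `K[x,y,z]` of the product of `n` projective planes, in `3n` unknowns:
the unknowns `(i, 0), (i, 1), (i, 2)` are `x_i, y_i, z_i`. -/
abbrev CoordRing (K : Type*) [Field K] (n : ℕ) : Type _ := MvPolynomial (Fin n × Fin 3) K

/-- The `n`-fold product of the projective plane. -/
abbrev PlaneProd (K : Type*) [Field K] (n : ℕ) : Type _ := Fin n → ℙ K (Fin 3 → K)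

/-- `f` is homogeneous of degree `u` in the `ℤⁿ`-grading `deg x_i = deg y_i = deg z_i = e_i`. -/
def IsMultihomogeneous (f : CoordRing K n) (u : Fin n → ℕ) : Prop :=
  ∀ m ∈ f.support, ∀ i, ∑ c : Fin 3, m (i, c) = u i

/-- `f` is linear in each group of unknowns `(x_i, y_i, z_i)` with `i ∈ σ`, and involves no other
unknowns. -/
def IsMultilinear (f : CoordRing K n) (σ : Finset (Fin n)) : Prop :=
  IsMultihomogeneous f (fun i => if i ∈ σ then 1 else 0)

def IsBilinear (f : CoordRing K n) : Prop :=
  ∃ σ : Finset (Fin n), σ.card = 2 ∧ IsMultilinear f σ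

def IsTrilinear (f : CoordRing K n) : Prop :=
  ∃ σ : Finset (Fin n), σ.card = 3 ∧ IsMultilinear f σ

/-- `f` vanishes at the point `p`, that is, at every tuple of homogeneous coordinates of `p`. -/
def VanishesAt (f : CoordRing K n) (p : PlaneProd K n) : Prop :=
  ∀ v : Fin n → Fin 3 → K, (∀ i, ∃ hi : v i ≠ 0, Projectivization.mk K (v i) hi = p i) →
    MvPolynomial.eval (fun q : Fin n × Fin 3 => v q.1 q.2) f = 0

/-- The Zariski closure in the product of projective planes, whose closed sets are the common zero
sets of multihomogeneous polynomials. -/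
def zariskiClosure (S : Set (PlaneProd K n)) : Set (PlaneProd K n) :=
  {p | ∀ (f : CoordRing K n) (u : Fin n → ℕ), IsMultihomogeneous f u →
    (∀ q ∈ S, VanishesAt f q) → VanishesAt f p}

/-- The ideal of all polynomials that vanish on `S`. -/
def vanishingIdeal (S : Set (PlaneProd K n)) : Ideal (CoordRing K n) where
  carrier := {f | ∀ p ∈ S, VanishesAt f p}
  add_mem' := by
    intro f g hf hg p hp v hv
    rw [map_add, hf p hp v hv, hg p hp v hv, add_zero]
  zero_mem' := by
    intro p _ v _
    exact map_zero _
  smul_mem' := by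
    intro c f hf p hp v hv
    rw [smul_eq_mul, map_mul, hf p hp v hv, mul_zero]

/-- The image of the rational map `x ↦ (A₁ x, …, Aₙ x)` from projective 3-space to the product of
projective planes; it is defined at the points at which no `A_i x` is zero. -/
def pictures (A : Fin n → Matrix (Fin 3) (Fin 4) K) : Set (PlaneProd K n) :=
  {p | ∃ (x : Fin 4 → K) (_ : x ≠ 0) (h : ∀ i, (A i).mulVec x ≠ 0),
    p = fun i => Projectivization.mk K ((A i).mulVec x) (h i)}

/-- The multiview variety `V_A`. -/
def multiviewVariety (A : Fin n → Matrix (Fin 3) (Fin 4) K) : Set (PlaneProd K n) :=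
  zariskiClosure (pictures A)

/-- The multiview ideal `J_A`. -/
def multiviewIdeal (A : Fin n → Matrix (Fin 3) (Fin 4) K) : Ideal (CoordRing K n) :=
  vanishingIdeal (multiviewVariety A)

/-- The focal point of a camera of rank 3, as the one-dimensional subspace `ker M` of `K⁴`. -/
def focalPoint (M : Matrix (Fin 3) (Fin 4) K) : Submodule K (Fin 4 → K) :=
  LinearMap.ker M.mulVecLin

/-- The focal points of the cameras in `s` lie on a common projective line. -/
def CollinearCameras (A : Fin n → Matrix (Fin 3) (Fin 4) K) (s : Finset (Fin n)) : Prop :=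
  ∃ W : Submodule K (Fin 4 → K), Module.finrank K W = 2 ∧ ∀ i ∈ s, focalPoint (A i) ≤ W

/-- The focal points of the cameras in `s` lie on a common projective plane. -/
def CoplanarCameras (A : Fin n → Matrix (Fin 3) (Fin 4) K) (s : Finset (Fin n)) : Prop :=
  ∃ W : Submodule K (Fin 4 → K), Module.finrank K W = 3 ∧ ∀ i ∈ s, focalPoint (A i) ≤ W

/-- Linearly general position: the focal points are distinct, no three are collinear and no four
are coplanar. -/
structure LinearlyGeneralPosition (A : Fin n → Matrix (Fin 3) (Fin 4) K) : Prop where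
  distinct : ∀ i j, i ≠ j → focalPoint (A i) ≠ focalPoint (A j)
  no_three_collinear : ∀ s : Finset (Fin n), s.card = 3 → ¬ CollinearCameras A s
  no_four_coplanar : ∀ s : Finset (Fin n), s.card = 4 → ¬ CoplanarCameras A s

/-- `G` generates the ideal `I`, no proper subset of `G` generates `I`, and no finite set with
fewer elements than `G` generates `I`. -/
structure MinimallyGenerates {R : Type*} [CommRing R] (G : Finset R) (I : Ideal R) : Prop where
  span_eq : Ideal.span (G : Set R) = I
  irredundant : ∀ H : Finset R, H ⊂ G → Ideal.span (H : Set R) ≠ I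
  card_le : ∀ H : Finset R, Ideal.span (H : Set R) = I → G.card ≤ H.card

end Multiview

namespace Multiview

open Module

variable {K : Type*} [Field K] {n : ℕ}

/-! For a linear form w on K⁴ vanishing at f_i, let w_i be the corresponding linear form in the i-th
group of unknowns (`Frame.lift`). Replacing every w_i by w is a ring map to K[K⁴], the pullback.
Since K is infinite, J_A consists of the polynomials all of whose multihomogeneous components have
zero pullback. Two cameras share a pencil of forms α, β through both foci, which gives α_i β_j − β_i
α_j. Three cameras give b_i c_j a_k − c_i a_j b_k, where a, b, c are the coordinates dual to the
three foci in a basis of K⁴. Let J be the ideal generated by one such polynomial for each pair and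
each triple.

To prove J_A ⊆ J, induct on the degree of a multihomogeneous f with zero pullback. If f has positive
degree in the i-th unknowns, choose a form a that vanishes at f_i and at no other focus. On the
plane a = 0 camera i is the projection from f_i, while every other camera is an isomorphism onto its
image plane. In coordinates adapted to this plane, J + (a_i) contains enough relations to swap
columns between rows (`mul_swap_of_generic`), always with a factor from row i at hand. So monomials
with the same degree and the same restriction to the plane agree
(`prod_map_eq_of_map_fst_eq_of_map_snd_eq`), and f ∈ J + (a_i) because f restricts to zero. Writing
f = p + a_i g with p in J, the component of g in the complementary degree again has zero pullback,
as K[K⁴] is a domain, and smaller degree.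

For minimality, each generator has a curve T ↦ (A_1 v_1 T, …, A_n v_n T) in affine space, through
the origin, on which it becomes a power of T and all other generators vanish. Hence the generators
are independent in J/𝔪J, with 𝔪 the irrelevant ideal, and no smaller set generates. Irredundance
follows by counting. -/

/-! ### Straightening monomials by row and column content -/

/-- Two products with the same row multiset and the same column multiset agree, provided the
variables satisfy the relations of the ideal of a point in the plane. -/
theorem prod_map_eq_of_map_fst_eq_of_map_snd_eq {ι Q : Type*} [CommRing Q] (i : ι)
    (z : ι × Fin 3 → Q)
    (h1 : ∀ j, j ≠ i → z (i, 0) * z (j, 1) = z (i, 1) * z (j, 0))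
    (h2 : ∀ c, c ≠ 2 → ∀ j k, j ≠ i → k ≠ i → ∀ d e,
      z (i, c) * (z (j, d) * z (k, e)) = z (i, c) * (z (j, e) * z (k, d))) :
    ∀ s t : Multiset (ι × Fin 3), s.map Prod.fst = t.map Prod.fst →
      s.map Prod.snd = t.map Prod.snd → i ∈ s.map Prod.fst → (i, 2) ∉ s → (i, 2) ∉ t →
      (s.map z).prod = (t.map z).prod := by
  classical
  intro s
  induction hN : s.card generalizing s with
  | zero =>
    intro t _ _ hi
    rw [Multiset.card_eq_zero] at hN
    simp [hN] at hi
  | succ N ih =>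
    intro t hf hs hi hs2 ht2
    by_cases hall : ∀ q ∈ s, q.1 = i
    · have key : ∀ r : Multiset (ι × Fin 3), (∀ q ∈ r, q.1 = i) →
          r = (r.map Prod.snd).map (fun d => (i, d)) := by
        intro r hr
        rw [Multiset.map_map]
        conv_lhs => rw [← Multiset.map_id r]
        refine Multiset.map_congr rfl fun q hq => ?_
        rw [← hr q hq]; rfl
      have hall' : ∀ q ∈ t, q.1 = i := by
        intro q hq
        have : q.1 ∈ s.map Prod.fst := by rw [hf]; exact Multiset.mem_map_of_mem _ hq
        obtain ⟨q', hq', e⟩ := Multiset.mem_map.1 this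
        rw [← e, hall q' hq']
      rw [key s hall, key t hall', hs]
    -- A factor in column 2 is removed first, if there is one. This priority guarantees that the
    -- exchange in `t` below never creates the forbidden factor (i, 2).
    · have hex : ∃ j d, (j, d) ∈ s ∧ j ≠ i ∧ (d = 2 ∨ (2 : Fin 3) ∉ s.map Prod.snd) := by
        by_cases h : (2 : Fin 3) ∈ s.map Prod.snd
        · obtain ⟨⟨j, d⟩, hq, rfl : d = 2⟩ := Multiset.mem_map.1 h
          exact ⟨j, 2, hq, fun e => hs2 (e ▸ hq), Or.inl rfl⟩
        · push Not at hall
          obtain ⟨⟨j, d⟩, hq, hne⟩ := hall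
          exact ⟨j, d, hq, hne, Or.inr h⟩
      obtain ⟨j, d, hjd, hj, hd⟩ := hex
      obtain ⟨s', rfl⟩ := Multiset.exists_cons_of_mem hjd
      suffices h : ∃ t' : Multiset (ι × Fin 3), (t.map z).prod = z (j, d) * (t'.map z).prod ∧
          t.map Prod.fst = j ::ₘ t'.map Prod.fst ∧ t.map Prod.snd = d ::ₘ t'.map Prod.snd ∧
          (i, 2) ∉ t' by
        obtain ⟨t', e, e1, e2, h2'⟩ := h
        rw [e, Multiset.map_cons, Multiset.prod_cons]
        congr 1
        rw [Multiset.map_cons, e1] at hf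
        rw [Multiset.map_cons, e2] at hs
        refine ih s' (by simpa using hN) t' (by simpa using hf) (by simpa using hs) ?_
          (fun h => hs2 (Multiset.mem_cons_of_mem h)) h2'
        rw [Multiset.map_cons, Multiset.mem_cons] at hi
        exact hi.resolve_left (Ne.symm hj)
      have hd' : d ∈ t.map Prod.snd := by rw [← hs]; exact Multiset.mem_map_of_mem Prod.snd hjd
      have hj' : j ∈ t.map Prod.fst := by rw [← hf]; exact Multiset.mem_map_of_mem Prod.fst hjd
      rw [hf] at hi
      obtain ⟨k, hk⟩ : ∃ k, (k, d) ∈ t := by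
        obtain ⟨⟨k, _⟩, hk, rfl⟩ := Multiset.mem_map.1 hd'; exact ⟨k, hk⟩
      obtain ⟨e, he⟩ : ∃ e, (j, e) ∈ t := by
        obtain ⟨⟨_, e⟩, he, rfl⟩ := Multiset.mem_map.1 hj'; exact ⟨e, he⟩
      obtain ⟨c, hc⟩ : ∃ c, (i, c) ∈ t := by
        obtain ⟨⟨_, c⟩, hc, rfl⟩ := Multiset.mem_map.1 hi; exact ⟨c, hc⟩
      by_cases hkj : k = j
      · subst hkj
        obtain ⟨t', rfl⟩ := Multiset.exists_cons_of_mem hk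
        exact ⟨t', by simp, by simp, by simp, fun h => ht2 (Multiset.mem_cons_of_mem h)⟩
      obtain ⟨t1, rfl⟩ := Multiset.exists_cons_of_mem hk
      have he1 : (j, e) ∈ t1 := by
        rcases Multiset.mem_cons.1 he with h | h
        · exact absurd (congrArg Prod.fst h).symm hkj
        · exact h
      obtain ⟨t0, rfl⟩ := Multiset.exists_cons_of_mem he1
      -- Exchange (k, d), (j, e) for (j, d), (k, e). If k = i this is a relation `h1`; otherwise
      -- `h2` applies, its multiplier being a factor of `t` in row i.
      refine ⟨(k, e) ::ₘ t0, ?_, ?_, by simp, ?_⟩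
      · by_cases hki : k = i
        · subst hki
          have hd2 : d ≠ 2 := by rintro rfl; exact ht2 hk
          have he2 : e ≠ 2 := by
            rintro rfl
            refine hd.resolve_left hd2 ?_
            rw [hs]; simp
          have : z (k, d) * z (j, e) = z (k, e) * z (j, d) := by
            have := h1 j hj
            fin_cases d <;> fin_cases e <;> simp_all
          simp only [Multiset.map_cons, Multiset.prod_cons]
          linear_combination (t0.map z).prod * this
        · have hc2 : c ≠ 2 := by rintro rfl; exact ht2 hc
          have hc0 : (i, c) ∈ t0 := by
            rcases Multiset.mem_cons.1 hc with h | h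
            · exact absurd (congrArg Prod.fst h).symm hki
            rcases Multiset.mem_cons.1 h with h | h
            · exact absurd (congrArg Prod.fst h).symm hj
            · exact h
          obtain ⟨t2, rfl⟩ := Multiset.exists_cons_of_mem hc0
          simp only [Multiset.map_cons, Multiset.prod_cons]
          linear_combination (t2.map z).prod * h2 c hc2 j k hj hki e d
      · simp only [Multiset.map_cons]; rw [Multiset.cons_swap]
      · intro h
        rcases Multiset.mem_cons.1 h with h | h
        · have hki : i = k := congrArg Prod.fst h
          have he2 : 2 = e := congrArg Prod.snd h
          subst hki he2
          refine hd.elim (fun h => ht2 (h ▸ hk)) (fun h => h ?_)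
          rw [hs]; simp
        · exact ht2 (by simp [h])

/-- A polynomial that is homogeneous for the row grading, and whose column specialization
vanishes, maps to zero under every evaluation as in
`prod_map_eq_of_map_fst_eq_of_map_snd_eq`. -/
theorem aeval_eq_zero_of_column_specialization {K ι Q : Type*} [Field K] [CommRing Q] [Algebra K Q]
    [DecidableEq ι] (i : ι) (z : ι × Fin 3 → Q) (h0 : z (i, 2) = 0)
    (h1 : ∀ j, j ≠ i → z (i, 0) * z (j, 1) = z (i, 1) * z (j, 0))
    (h2 : ∀ c, c ≠ 2 → ∀ j k, j ≠ i → k ≠ i → ∀ d e,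
      z (i, c) * (z (j, d) * z (k, e)) = z (i, c) * (z (j, e) * z (k, d)))
    (f : MvPolynomial (ι × Fin 3) K) (u : ι →₀ ℕ) (hu : u i ≠ 0)
    (hf : ∀ m ∈ f.support, m.mapDomain Prod.fst = u)
    (hcol : MvPolynomial.aeval
      (fun q : ι × Fin 3 => if q = (i, 2) then 0 else (MvPolynomial.X q.2 : MvPolynomial (Fin 3) K))
      f = 0) :
    MvPolynomial.aeval z f = 0 := by
  classical
  set s := f.support.filter (fun m => m (i, 2) = 0) with hs
  have hz : ∀ m ∈ f.support, m ∉ s → m.prod (fun q k => z q ^ k) = 0 := by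
    intro m hm hms
    have hne : m (i, 2) ≠ 0 := fun h => hms (Finset.mem_filter.2 ⟨hm, h⟩)
    exact Finset.prod_eq_zero (i := (i, 2)) (Finsupp.mem_support_iff.2 hne)
      (by simp [h0, hne])
  have hsum : MvPolynomial.aeval z f =
      ∑ m ∈ s, f.coeff m • m.prod (fun q k => z q ^ k) := by
    rw [MvPolynomial.aeval_def, MvPolynomial.eval₂_eq]
    symm
    have e : ∀ m, f.coeff m • m.prod (fun q k => z q ^ k) =
        (algebraMap K Q) (f.coeff m) * ∏ q ∈ m.support, z q ^ m q := by
      intro m; rw [Algebra.smul_def]; rfl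
    simp_rw [← e]
    exact Finset.sum_subset (Finset.filter_subset _ _) fun m hm hms => by rw [hz m hm hms, smul_zero]
  -- Monomials containing (i, 2) die in both evaluations. Among the others, the column
  -- specialization sees only the column content τ, so its coefficient at τ is this sum.
  have hcolz : ∀ τ : Fin 3 →₀ ℕ, ∑ m ∈ s with m.mapDomain Prod.snd = τ, f.coeff m = 0 := by
    intro τ
    have hc := congrArg (MvPolynomial.coeff τ) hcol
    rw [MvPolynomial.aeval_def, MvPolynomial.eval₂_eq, MvPolynomial.coeff_sum,
      MvPolynomial.coeff_zero] at hc
    rw [← hc, Finset.sum_filter, hs, Finset.sum_filter]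
    refine Finset.sum_congr rfl fun m hm => ?_
    rw [MvPolynomial.algebraMap_eq, MvPolynomial.coeff_C_mul]
    by_cases hm2 : m (i, 2) = 0
    · have : ∏ q ∈ m.support, (if q = (i, 2) then 0 else
          (MvPolynomial.X q.2 : MvPolynomial (Fin 3) K)) ^ m q =
          MvPolynomial.monomial (m.mapDomain Prod.snd) 1 := by
        rw [MvPolynomial.monomial_eq, MvPolynomial.C_1, one_mul,
          Finsupp.prod_mapDomain_index (by simp) (by intros; rw [pow_add])]
        refine Finset.prod_congr rfl fun q hq => ?_
        rw [if_neg]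
        rintro rfl
        exact Finsupp.mem_support_iff.1 hq hm2
      rw [this, MvPolynomial.coeff_monomial, if_pos hm2, mul_ite, mul_one, mul_zero]
    · rw [if_neg hm2, Finset.prod_eq_zero (i := (i, 2)) (Finsupp.mem_support_iff.2 hm2),
        MvPolynomial.coeff_zero, mul_zero]
      simp [hm2]
  have hprod : ∀ m ∈ s, ∀ m' ∈ s, m.mapDomain Prod.snd = m'.mapDomain Prod.snd →
      m.prod (fun q k => z q ^ k) = m'.prod (fun q k => z q ^ k) := by
    intro m hm m' hm' e
    have hm1 := Finset.mem_filter.1 hm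
    have hm1' := Finset.mem_filter.1 hm'
    have hp : ∀ m : ι × Fin 3 →₀ ℕ, m.prod (fun q k => z q ^ k) = (m.toMultiset.map z).prod := by
      intro m
      rw [Finsupp.toMultiset_map, Finsupp.prod_toMultiset,
        Finsupp.prod_mapDomain_index (by simp) (by intros; rw [pow_add])]
    rw [hp, hp]
    apply prod_map_eq_of_map_fst_eq_of_map_snd_eq i z h1 h2
    · rw [Finsupp.toMultiset_map, Finsupp.toMultiset_map, hf m hm1.1, hf m' hm1'.1]
    · rw [Finsupp.toMultiset_map, Finsupp.toMultiset_map, e]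
    · rw [Finsupp.toMultiset_map, hf m hm1.1, Finsupp.mem_toMultiset, Finsupp.mem_support_iff]
      exact hu
    · simpa [Finsupp.mem_toMultiset] using hm1.2
    · simpa [Finsupp.mem_toMultiset] using hm1'.2
  rw [hsum, ← Finset.sum_fiberwise_of_maps_to
    (fun m hm => Finset.mem_image_of_mem (fun m : ι × Fin 3 →₀ ℕ => m.mapDomain Prod.snd) hm)]
  refine Finset.sum_eq_zero fun τ hτ => ?_
  obtain ⟨m0, hm0, rfl⟩ := Finset.mem_image.1 hτ
  have := hcolz (m0.mapDomain Prod.snd)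
  rw [Finset.sum_congr rfl (g := fun m => f.coeff m • m0.prod (fun q k => z q ^ k)),
    ← Finset.sum_smul, this, zero_smul]
  intro m hm
  rw [Finset.mem_filter] at hm
  rw [hprod m hm.1 m0 hm0 hm.2]

/-! ### Linear forms through the focal points and their lifts -/

/-- The linear form on `K⁴` given by a row of a camera. -/
def row (M : Matrix (Fin 3) (Fin 4) K) (c : Fin 3) : Dual K (Fin 4 → K) :=
  LinearMap.proj c ∘ₗ M.mulVecLin

theorem row_apply (M : Matrix (Fin 3) (Fin 4) K) (c : Fin 3) (x : Fin 4 → K) :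
    row M c x = M.mulVec x c := rfl

/-- The forms vanishing on ker M are the image of the transpose of M, which is injective because M
is surjective. The map `g` is a left inverse of the transpose, read in coordinates. It is defined on
all forms for the sake of linearity, but has a meaning only on those that vanish at `F`. -/
theorem exists_focus_coef (M : Matrix (Fin 3) (Fin 4) K) (hM : M.rank = 3) :
    ∃ (F : Fin 4 → K) (g : Dual K (Fin 4 → K) →ₗ[K] (Fin 3 → K)),
      F ≠ 0 ∧ focalPoint M = Submodule.span K {F} ∧
      (∀ w, w F = 0 → ∀ x, ∑ c, g w c * M.mulVec x c = w x) ∧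
      ∀ c, g (row M c) = Pi.single c 1 := by
  have hr : finrank K (LinearMap.range M.mulVecLin) = 3 := hM
  have hk : finrank K (focalPoint M) = 1 := by
    have := LinearMap.finrank_range_add_finrank_ker M.mulVecLin
    rw [hr, finrank_fin_fun] at this
    change 3 + finrank K (focalPoint M) = 4 at this
    omega
  have hsurj : Function.Surjective M.mulVecLin := by
    rw [← LinearMap.range_eq_top]
    exact Submodule.eq_top_of_finrank_eq (by rw [hr, finrank_fin_fun])
  obtain ⟨⟨F, hF⟩, hF0, hsp⟩ := finrank_eq_one_iff'.1 hk
  have hspan : focalPoint M = Submodule.span K {F} := by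
    apply le_antisymm
    · intro x hx
      obtain ⟨c, hc⟩ := hsp ⟨x, hx⟩
      exact Submodule.mem_span_singleton.2 ⟨c, congrArg Subtype.val hc⟩
    · rw [Submodule.span_singleton_le_iff_mem]; exact hF
  have hinj : Function.Injective M.mulVecLin.dualMap :=
    LinearMap.dualMap_injective_of_surjective hsurj
  obtain ⟨G, hG⟩ := LinearMap.exists_leftInverse_of_injective M.mulVecLin.dualMap
    (LinearMap.ker_eq_bot.2 hinj)
  have hG' : ∀ ψ, G (M.mulVecLin.dualMap ψ) = ψ := fun ψ => LinearMap.congr_fun hG ψ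
  refine ⟨F, LinearMap.pi (fun c => Dual.eval K (Fin 3 → K) (Pi.single c 1) ∘ₗ G), ?_, hspan,
    ?_, ?_⟩
  · rintro rfl; exact hF0 rfl
  · intro w hw x
    have hmem : w ∈ LinearMap.range M.mulVecLin.dualMap := by
      rw [LinearMap.range_dualMap_eq_dualAnnihilator_ker, Submodule.mem_dualAnnihilator]
      intro y hy
      change y ∈ focalPoint M at hy
      rw [hspan, Submodule.mem_span_singleton] at hy
      obtain ⟨c, rfl⟩ := hy
      rw [map_smul, hw, smul_zero]
    obtain ⟨ψ, rfl⟩ := hmem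
    simp only [LinearMap.pi_apply, LinearMap.comp_apply, hG', Dual.eval_apply]
    rw [LinearMap.dualMap_apply, LinearMap.pi_apply_eq_sum_univ ψ]
    refine Finset.sum_congr rfl fun c _ => ?_
    rw [smul_eq_mul, mul_comm]
    congr 2
    ext d
    simp [Pi.single_apply, eq_comm]
  · intro c
    have : row M c = M.mulVecLin.dualMap (LinearMap.proj c) := rfl
    ext d
    simp [this, hG', Pi.single_apply, eq_comm]

/-- For every camera a generator of its focal point, and a linear choice of coordinates for the
linear forms vanishing there with respect to the rows of the camera. -/
structure Frame (A : Fin n → Matrix (Fin 3) (Fin 4) K) where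
  focus : Fin n → Fin 4 → K
  focus_ne_zero : ∀ i, focus i ≠ 0
  focalPoint_eq : ∀ i, focalPoint (A i) = Submodule.span K {focus i}
  coef : Fin n → Dual K (Fin 4 → K) →ₗ[K] (Fin 3 → K)
  sum_coef : ∀ i w, w (focus i) = 0 → ∀ x, ∑ c, coef i w c * (A i).mulVec x c = w x
  coef_row : ∀ i c, coef i (row (A i) c) = Pi.single c 1

theorem nonempty_frame {A : Fin n → Matrix (Fin 3) (Fin 4) K} (hA : ∀ i, (A i).rank = 3) :
    Nonempty (Frame A) := by
  choose F g h1 h2 h3 h4 using fun i => exists_focus_coef (A i) (hA i)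
  exact ⟨⟨F, h1, h2, g, h3, h4⟩⟩

namespace Frame

variable {A : Fin n → Matrix (Fin 3) (Fin 4) K} (D : Frame A)

theorem mulVec_focus (i : Fin n) : (A i).mulVec (D.focus i) = 0 := by
  have : D.focus i ∈ focalPoint (A i) := by
    rw [D.focalPoint_eq]; exact Submodule.mem_span_singleton_self _
  exact this

theorem row_focus (i : Fin n) (c : Fin 3) : row (A i) c (D.focus i) = 0 := by
  rw [row_apply, D.mulVec_focus]; rfl

/-- The linear form in the unknowns of the `i`-th plane that corresponds to a linear form on `K⁴`
vanishing at the `i`-th focal point. -/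
noncomputable def lift (i : Fin n) : Dual K (Fin 4 → K) →ₗ[K] CoordRing K n :=
  (Fintype.linearCombination K (fun c : Fin 3 => (MvPolynomial.X (i, c) : CoordRing K n))) ∘ₗ
    D.coef i

theorem lift_apply (i : Fin n) (w : Dual K (Fin 4 → K)) :
    D.lift i w = ∑ c, D.coef i w c • (MvPolynomial.X (i, c) : CoordRing K n) := rfl

theorem lift_row (i : Fin n) (c : Fin 3) :
    D.lift i (row (A i) c) = MvPolynomial.X (i, c) := by
  simp [lift_apply, D.coef_row, Pi.single_apply]

/-- An evaluation whose values on the unknowns of the `i`-th plane are linear in the rows extends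
this linear dependence to all lifted forms. -/
theorem aeval_lift {R : Type*} [CommRing R] [Algebra K R] (z : Fin n × Fin 3 → R) (i : Fin n)
    (ℓ : Dual K (Fin 4 → K) →ₗ[K] R) (hz : ∀ c, z (i, c) = ℓ (row (A i) c))
    (w : Dual K (Fin 4 → K)) (hw : w (D.focus i) = 0) :
    MvPolynomial.aeval z (D.lift i w) = ℓ w := by
  have : w = ∑ c, D.coef i w c • row (A i) c := by
    refine LinearMap.ext fun x => ?_
    rw [← D.sum_coef i w hw]
    simp [row_apply]
  rw [lift_apply, map_sum]
  conv_rhs => rw [this]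
  simp [hz]

end Frame

/-! ### Multigrading, pullback and the multiview ideal -/

/-- The weights of the `ℤⁿ`-grading. -/
def weights (q : Fin n × Fin 3) : Fin n → ℕ := Pi.single q.1 1

theorem weight_weights (m : Fin n × Fin 3 →₀ ℕ) (i : Fin n) :
    Finsupp.weight weights m i = ∑ c : Fin 3, m (i, c) := by
  rw [Finsupp.weight_apply, Finsupp.sum_fintype _ _ (by simp), Finset.sum_apply,
    Fintype.sum_prod_type, Finset.sum_eq_single i]
  · simp [weights]
  · intro j _ hj; simp [weights, hj.symm]
  · simp

theorem isMultihomogeneous_iff {f : CoordRing K n} {u : Fin n → ℕ} :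
    IsMultihomogeneous f u ↔ MvPolynomial.IsWeightedHomogeneous weights f u := by
  unfold IsMultihomogeneous MvPolynomial.IsWeightedHomogeneous
  simp only [MvPolynomial.mem_support_iff, funext_iff, weight_weights]

theorem weight_weights_eq_mapDomain (m : Fin n × Fin 3 →₀ ℕ) :
    Finsupp.weight weights m = m.mapDomain Prod.fst := by
  classical
  ext i
  rw [weight_weights, Finsupp.mapDomain, Finsupp.sum_fintype _ _ (by simp),
    Finsupp.finsetSum_apply, Fintype.sum_prod_type, Finset.sum_eq_single i]
  · simp
  · intro j _ hj; simp [hj]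
  · simp

theorem Frame.isWeightedHomogeneous_lift {A : Fin n → Matrix (Fin 3) (Fin 4) K} (D : Frame A)
    (i : Fin n) (w : Dual K (Fin 4 → K)) :
    MvPolynomial.IsWeightedHomogeneous weights (D.lift i w) (Pi.single i 1) := by
  rw [D.lift_apply]
  refine MvPolynomial.IsWeightedHomogeneous.sum _ _ _ fun c _ => ?_
  rw [MvPolynomial.smul_eq_C_mul]
  exact (MvPolynomial.isWeightedHomogeneous_X K weights (i, c)).C_mul _

/-- The linear polynomial of a linear form. -/
noncomputable def linPoly : Dual K (Fin 4 → K) →ₗ[K] MvPolynomial (Fin 4) K :=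
  ∑ d : Fin 4, LinearMap.toSpanSingleton K _ (MvPolynomial.X d) ∘ₗ
    Dual.eval K (Fin 4 → K) (Pi.single d 1)

theorem linPoly_apply (w : Dual K (Fin 4 → K)) :
    linPoly w = ∑ d : Fin 4, w (Pi.single d 1) • (MvPolynomial.X d : MvPolynomial (Fin 4) K) := by
  simp [linPoly]

theorem eval_linPoly (w : Dual K (Fin 4 → K)) (x : Fin 4 → K) :
    MvPolynomial.eval x (linPoly w) = w x := by
  rw [linPoly_apply, map_sum, LinearMap.pi_apply_eq_sum_univ w x]
  refine Finset.sum_congr rfl fun d _ => ?_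
  rw [MvPolynomial.smul_eval, MvPolynomial.eval_X, smul_eq_mul, mul_comm]
  congr 2
  ext e; simp [Pi.single_apply, eq_comm]

theorem linPoly_ne_zero {w : Dual K (Fin 4 → K)} (hw : w ≠ 0) : linPoly w ≠ 0 := by
  intro h
  apply hw
  exact LinearMap.ext fun y => by rw [← eval_linPoly, h]; simp

/-- Pulling back to the coordinate ring of projective 3-space. -/
noncomputable def pullback (A : Fin n → Matrix (Fin 3) (Fin 4) K) :
    CoordRing K n →ₐ[K] MvPolynomial (Fin 4) K :=
  MvPolynomial.aeval fun q => linPoly (row (A q.1) q.2)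

theorem Frame.pullback_lift {A : Fin n → Matrix (Fin 3) (Fin 4) K} (D : Frame A) (i : Fin n)
    (w : Dual K (Fin 4 → K)) (hw : w (D.focus i) = 0) :
    pullback A (D.lift i w) = linPoly w :=
  D.aeval_lift _ i linPoly (fun _ => rfl) w hw

theorem eval_pullback (A : Fin n → Matrix (Fin 3) (Fin 4) K) (f : CoordRing K n)
    (x : Fin 4 → K) :
    MvPolynomial.eval x (pullback A f) =
      MvPolynomial.eval (fun q : Fin n × Fin 3 => (A q.1).mulVec x q.2) f := by
  rw [pullback, MvPolynomial.aeval_def, MvPolynomial.algebraMap_eq, MvPolynomial.eval_eval₂]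
  have : (MvPolynomial.eval x).comp MvPolynomial.C = RingHom.id K := by ext; simp
  rw [this]
  simp only [eval_linPoly, row_apply]
  rfl

theorem IsMultihomogeneous.eval_mul {f : CoordRing K n} {u : Fin n → ℕ}
    (hf : IsMultihomogeneous f u) (c : Fin n → K) (v : Fin n × Fin 3 → K) :
    MvPolynomial.eval (fun q => c q.1 * v q) f = (∏ i, c i ^ u i) * MvPolynomial.eval v f := by
  rw [MvPolynomial.eval_eq', MvPolynomial.eval_eq', Finset.mul_sum]
  refine Finset.sum_congr rfl fun m hm => ?_
  simp_rw [mul_pow, Finset.prod_mul_distrib]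
  have : ∏ q : Fin n × Fin 3, c q.1 ^ m q = ∏ i, c i ^ u i := by
    rw [Fintype.prod_prod_type]
    refine Finset.prod_congr rfl fun i _ => ?_
    rw [← hf m hm i, ← Finset.prod_pow_eq_pow_sum]
  rw [this]; ring

/-- The coefficients of a generic rescaling are the values of the multihomogeneous components. -/
theorem coeff_aeval_C_mul_X (f : CoordRing K n) (v : Fin n × Fin 3 → K) (u : Fin n →₀ ℕ) :
    MvPolynomial.coeff u (MvPolynomial.aeval
      (fun q : Fin n × Fin 3 => MvPolynomial.C (v q) * MvPolynomial.X q.1) f) =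
    MvPolynomial.eval v (MvPolynomial.weightedHomogeneousComponent weights (u : Fin n → ℕ) f) := by
  classical
  induction f using MvPolynomial.induction_on' with
  | add p q hp hq => rw [map_add, MvPolynomial.coeff_add, hp, hq, map_add, map_add]
  | monomial m a =>
    have h1 : MvPolynomial.aeval (fun q : Fin n × Fin 3 =>
        (MvPolynomial.C (v q) * MvPolynomial.X q.1 : MvPolynomial (Fin n) K))
        (MvPolynomial.monomial m a) =
        MvPolynomial.monomial (m.mapDomain Prod.fst) (a * m.prod fun q k => v q ^ k) := by
      rw [MvPolynomial.aeval_monomial, MvPolynomial.monomial_eq (s := m.mapDomain Prod.fst),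
        Finsupp.prod_mapDomain_index (by simp) (by intros; rw [pow_add]), MvPolynomial.C_mul,
        MvPolynomial.algebraMap_eq, mul_assoc]
      congr 1
      simp only [Finsupp.prod, map_prod, ← Finset.prod_mul_distrib, map_pow, mul_pow]
    rw [h1, MvPolynomial.coeff_monomial, MvPolynomial.weightedHomogeneousComponent_of_mem
      (MvPolynomial.isWeightedHomogeneous_monomial weights m a rfl), weight_weights_eq_mapDomain]
    simp only [DFunLike.coe_fn_eq, @eq_comm _ u]
    split_ifs
    · rw [MvPolynomial.eval_monomial]
    · rw [map_zero]

/-- The product of `p` with all `q i` vanishes identically, and a polynomial ring over an infinite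
field has no zero divisors and no nonzero polynomial that vanishes everywhere. -/
theorem eq_zero_of_eval_eq_zero_of_ne_zero [Infinite K] {σ ι : Type*} [Fintype ι]
    (p : MvPolynomial σ K) (q : ι → MvPolynomial σ K) (hq : ∀ i, q i ≠ 0)
    (h : ∀ x, (∀ i, MvPolynomial.eval x (q i) ≠ 0) → MvPolynomial.eval x p = 0) : p = 0 := by
  have : p * ∏ i, q i = 0 := by
    apply MvPolynomial.funext
    intro x
    rw [map_mul, map_prod, map_zero]
    by_cases hx : ∀ i, MvPolynomial.eval x (q i) ≠ 0
    · rw [h x hx, zero_mul]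
    · push Not at hx
      obtain ⟨i, hi⟩ := hx
      rw [Finset.prod_eq_zero (Finset.mem_univ i) hi, mul_zero]
  exact (mul_eq_zero.1 this).resolve_right (Finset.prod_ne_zero_iff.2 fun i _ => hq i)

theorem pictures_subset_multiviewVariety (A : Fin n → Matrix (Fin 3) (Fin 4) K) :
    pictures A ⊆ multiviewVariety A := fun p hp _ _ _ h => h p hp

theorem Frame.row_ne_zero {A : Fin n → Matrix (Fin 3) (Fin 4) K} (D : Frame A) (i : Fin n)
    (c : Fin 3) : row (A i) c ≠ 0 := by
  intro h
  have := congrFun (D.coef_row i c) c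
  rw [h, map_zero] at this
  simp at this

/-- Multihomogeneity makes vanishing independent of the chosen homogeneous coordinates, and `f`
itself is one of the equations cutting out the Zariski closure. -/
theorem mem_multiviewIdeal_of_pullback_eq_zero {A : Fin n → Matrix (Fin 3) (Fin 4) K}
    {f : CoordRing K n} {u : Fin n → ℕ} (hf : IsMultihomogeneous f u) (h : pullback A f = 0) :
    f ∈ multiviewIdeal A := by
  intro p hp
  refine hp f u hf ?_
  rintro q ⟨x, hx, hAx, rfl⟩ v hv
  choose hv0 hv using hv
  choose c hc using fun i => (Projectivization.mk_eq_mk_iff' K _ _ (hv0 i) (hAx i)).1 (hv i)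
  have : (fun q : Fin n × Fin 3 => v q.1 q.2) =
      fun q => c q.1 * (fun q : Fin n × Fin 3 => (A q.1).mulVec x q.2) q := by
    ext q
    rw [← hc]; rfl
  rw [this, hf.eval_mul, ← eval_pullback, h, map_zero, mul_zero]

/-- Vanishing at every tuple of homogeneous coordinates allows independent rescaling in the n
factors. As a polynomial in the scaling parameters, f at the picture of x has the values of its
components as coefficients, so each component vanishes separately. -/
theorem Frame.mem_multiviewIdeal_iff [Infinite K] {A : Fin n → Matrix (Fin 3) (Fin 4) K}
    (D : Frame A) (hn : 0 < n) {f : CoordRing K n} :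
    f ∈ multiviewIdeal A ↔ ∀ u : Fin n → ℕ,
      pullback A (MvPolynomial.weightedHomogeneousComponent weights u f) = 0 := by
  constructor
  · intro hf u
    refine eq_zero_of_eval_eq_zero_of_ne_zero _ (fun i => linPoly (row (A i) 0))
      (fun i => linPoly_ne_zero (D.row_ne_zero i 0)) fun x hx => ?_
    have hAx : ∀ i, (A i).mulVec x ≠ 0 := by
      intro i h
      apply hx i
      rw [eval_linPoly, row_apply, h]; rfl
    have hx0 : x ≠ 0 := by
      rintro rfl
      exact hAx ⟨0, hn⟩ (Matrix.mulVec_zero _)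
    rw [eval_pullback]
    have hg : MvPolynomial.aeval (fun q : Fin n × Fin 3 =>
        (MvPolynomial.C ((A q.1).mulVec x q.2) * MvPolynomial.X q.1 : MvPolynomial (Fin n) K))
        f = 0 := by
      refine eq_zero_of_eval_eq_zero_of_ne_zero _ (fun i => MvPolynomial.X i)
        (fun i => MvPolynomial.X_ne_zero i) fun c hc => ?_
      simp only [MvPolynomial.eval_X] at hc
      rw [MvPolynomial.aeval_def, MvPolynomial.algebraMap_eq, MvPolynomial.eval_eval₂]
      have : (MvPolynomial.eval c).comp MvPolynomial.C = RingHom.id K := by ext; simp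
      rw [this]
      simp only [map_mul, MvPolynomial.eval_C, MvPolynomial.eval_X]
      refine hf _ (pictures_subset_multiviewVariety A ⟨x, hx0, hAx, rfl⟩)
        (fun i d => (A i).mulVec x d * c i) fun i => ?_
      have e : (fun d => (A i).mulVec x d * c i) = c i • (A i).mulVec x := by
        ext d; simp [mul_comm]
      refine ⟨by rw [e]; exact smul_ne_zero (hc i) (hAx i), ?_⟩
      rw [Projectivization.mk_eq_mk_iff']
      exact ⟨c i, e.symm⟩
    have := coeff_aeval_C_mul_X f (fun q => (A q.1).mulVec x q.2) (Finsupp.equivFunOnFinite.symm u)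
    rw [hg, MvPolynomial.coeff_zero] at this
    exact this.symm
  · intro h
    rw [← MvPolynomial.sum_weightedHomogeneousComponent weights f,
      finsum_eq_sum _ (MvPolynomial.weightedHomogeneousComponent_finsupp f)]
    exact Ideal.sum_mem _ fun u _ => mem_multiviewIdeal_of_pullback_eq_zero
      (isMultihomogeneous_iff.2
        (MvPolynomial.weightedHomogeneousComponent_isWeightedHomogeneous u f)) (h u)

/-! ### Adapted coordinates and general position -/

theorem exists_basis_of_linearIndependent_three {a b c : Fin 4 → K}
    (h : LinearIndependent K ![a, b, c]) :
    ∃ B : Basis (Fin 4) K (Fin 4 → K), B 1 = a ∧ B 2 = b ∧ B 3 = c := by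
  obtain ⟨o, ho⟩ := exists_linearIndependent_cons_of_lt_finrank h (by simp)
  refine ⟨basisOfLinearIndependentOfCardEqFinrank ho (by simp), ?_, ?_, ?_⟩ <;>
  simp only [coe_basisOfLinearIndependentOfCardEqFinrank] <;> rfl

theorem exists_basis_of_linearIndependent_two {a b : Fin 4 → K}
    (h : LinearIndependent K ![a, b]) :
    ∃ B : Basis (Fin 4) K (Fin 4 → K), B 2 = a ∧ B 3 = b := by
  obtain ⟨o, ho⟩ := exists_linearIndependent_cons_of_lt_finrank h (by simp)
  obtain ⟨B, _, h2, h3⟩ := exists_basis_of_linearIndependent_three (a := o) (b := a) (c := b) ho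
  exact ⟨B, h2, h3⟩

theorem dual_eq_sum_coord (B : Basis (Fin 4) K (Fin 4 → K)) (w : Dual K (Fin 4 → K)) :
    w = w (B 0) • B.coord 0 + w (B 1) • B.coord 1 + w (B 2) • B.coord 2 + w (B 3) • B.coord 3 := by
  rw [← Fin.sum_univ_four (fun d => w (B d) • B.coord d), B.sum_dual_apply_smul_coord]

/-- Coordinates adapted to a point on a plane in projective 3-space. -/
theorem exists_adapted_coordinates {F : Fin 4 → K} (hF : F ≠ 0) {a : Dual K (Fin 4 → K)}
    (ha : a ≠ 0) (haF : a F = 0) :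
    ∃ (b : Fin 3 → Dual K (Fin 4 → K)) (y : Fin 3 → Fin 4 → K) (e : Fin 4 → K),
      (∀ c d, b c (y d) = if c = d then 1 else 0) ∧ (∀ d, a (y d) = 0) ∧ y 2 = F ∧
      ∀ w : Dual K (Fin 4 → K), w = ∑ d, w (y d) • b d + w e • a := by
  obtain ⟨e, he⟩ : ∃ e, a e = 1 := by
    obtain ⟨e, he⟩ : ∃ e, a e ≠ 0 := by
      by_contra! h
      exact ha (LinearMap.ext h)
    exact ⟨(a e)⁻¹ • e, by simp [he]⟩
  have hli : LinearIndependent K ![F, e] := by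
    rw [LinearIndependent.pair_iff' hF]
    rintro c rfl
    simp [haF] at he
  obtain ⟨B, h2, h3⟩ := exists_basis_of_linearIndependent_two hli
  -- The vectors `y` are the basis vectors projected into the plane a = 0 along `e`. The forms `b`
  -- are zero at `e`, so they stay dual to `y`.
  refine ⟨![B.coord 0, B.coord 1, B.coord 2], ![B 0 - a (B 0) • e, B 1 - a (B 1) • e, F], e,
    ?_, ?_, rfl, ?_⟩
  · rw [← h2, ← h3]
    intro c d
    fin_cases c <;> fin_cases d <;> simp
  · intro d
    fin_cases d <;> simp [he, haF]
  · intro w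
    have hw := dual_eq_sum_coord B w
    have haB := dual_eq_sum_coord B a
    rw [h2, h3, he, haF] at haB
    rw [h2, h3] at hw
    simp only [Fin.sum_univ_three, Matrix.cons_val_zero, Matrix.cons_val_one, Matrix.cons_val,
      map_sub, map_smul]
    generalize B.coord 0 = b0 at *
    generalize B.coord 1 = b1 at *
    generalize B.coord 2 = b2 at *
    generalize B.coord 3 = b3 at *
    simp only [smul_eq_mul]
    have : w e • a = w e • (a (B 0) • b0 + a (B 1) • b1 + (0 : K) • b2 + (1 : K) • b3) := by
      rw [← haB]
    rw [this]
    conv_lhs => rw [hw]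
    module

namespace Frame

variable {A : Fin n → Matrix (Fin 3) (Fin 4) K} (D : Frame A)

theorem linearIndependent_pair (hA : LinearlyGeneralPosition A) {i j : Fin n} (hij : i ≠ j) :
    LinearIndependent K ![D.focus i, D.focus j] := by
  rw [LinearIndependent.pair_iff' (D.focus_ne_zero i)]
  intro c hc
  apply hA.distinct i j hij
  have hc0 : c ≠ 0 := by
    rintro rfl
    exact D.focus_ne_zero j (by rw [← hc, zero_smul])
  rw [D.focalPoint_eq, D.focalPoint_eq, ← hc,
    Submodule.span_singleton_smul_eq (IsUnit.mk0 c hc0)]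

theorem linearIndependent_triple (hA : LinearlyGeneralPosition A) {i j k : Fin n} (hij : i ≠ j)
    (hik : i ≠ k) (hjk : j ≠ k) :
    LinearIndependent K ![D.focus i, D.focus j, D.focus k] := by
  have hp := D.linearIndependent_pair hA hjk
  refine linearIndependent_finCons.2 ⟨hp, fun hmem => ?_⟩
  refine hA.no_three_collinear {i, j, k} (Finset.card_eq_three.2 ⟨i, j, k, hij, hik, hjk, rfl⟩)
    ⟨Submodule.span K (Set.range ![D.focus j, D.focus k]), by
      rw [finrank_span_eq_card hp]; simp, ?_⟩
  intro l hl
  rw [D.focalPoint_eq, Submodule.span_singleton_le_iff_mem]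
  simp only [Finset.mem_insert, Finset.mem_singleton] at hl
  rcases hl with rfl | rfl | rfl
  · exact hmem
  · exact Submodule.subset_span ⟨0, rfl⟩
  · exact Submodule.subset_span ⟨1, rfl⟩

/-- Modulo the line of the i-th focus all other foci stay nonzero, and over an infinite field some
form avoids finitely many nonzero vectors. -/
theorem exists_generic_form [Infinite K] (hA : LinearlyGeneralPosition A) (i : Fin n) :
    ∃ a : Dual K (Fin 4 → K), a ≠ 0 ∧ a (D.focus i) = 0 ∧ ∀ j, j ≠ i → a (D.focus j) ≠ 0 := by
  let S := Submodule.span K {D.focus i}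
  have hS : ∀ j, j ≠ i → S.mkQ (D.focus j) ≠ 0 := by
    intro j hj h
    rw [Submodule.mkQ_apply, Submodule.Quotient.mk_eq_zero, Submodule.mem_span_singleton] at h
    obtain ⟨c, hc⟩ := h
    exact (LinearIndependent.pair_iff' (D.focus_ne_zero i)).1
      (D.linearIndependent_pair hA hj.symm) c hc
  -- This extra vector to avoid forces a ≠ 0 even when there is no other camera.
  have hne : ∃ z : (Fin 4 → K) ⧸ S, z ≠ 0 := by
    by_contra! h
    have h1 : S = ⊤ := by
      rw [eq_top_iff]
      intro x _
      exact (Submodule.Quotient.mk_eq_zero S).1 (h _)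
    have h2 : finrank K S = 1 := finrank_span_singleton (D.focus_ne_zero i)
    rw [h1, finrank_top, finrank_fin_fun] at h2
    omega
  obtain ⟨z, hz⟩ := hne
  obtain ⟨f, hf⟩ := Module.exists_dual_forall_apply_ne_zero (K := K)
    (fun o : Option {j // j ≠ i} => o.elim z fun j => S.mkQ (D.focus j))
    (by rintro (_ | ⟨j, hj⟩); exacts [hz, hS j hj])
  refine ⟨f ∘ₗ S.mkQ, ?_, ?_, fun j hj => hf (some ⟨j, hj⟩)⟩
  · intro h
    obtain ⟨x, rfl⟩ := S.mkQ_surjective z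
    exact hf none (LinearMap.congr_fun h x)
  · rw [LinearMap.comp_apply, Submodule.mkQ_apply, (Submodule.Quotient.mk_eq_zero S).2
      (Submodule.mem_span_singleton_self _), map_zero]

end Frame

/-! ### Exchanging columns modulo a generic form -/

/-- Modulo a generic linear form through the `i`-th focal point, the linear forms on the other
planes become interchangeable after multiplication by a form on the `i`-th plane. -/
theorem mul_swap_of_generic {ι Q : Type*} [CommRing Q] [Algebra K Q]
    (F : ι → Fin 4 → K) (x : ι → Dual K (Fin 4 → K) →ₗ[K] Q)
    (hb : ∀ i j, i ≠ j → ∀ α β : Dual K (Fin 4 → K), α (F i) = 0 → α (F j) = 0 → β (F i) = 0 →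
      β (F j) = 0 → x i α * x j β = x i β * x j α)
    (ht : ∀ i j k, i ≠ j → i ≠ k → j ≠ k → ∃ B : Basis (Fin 4) K (Fin 4 → K),
      B 1 = F i ∧ B 2 = F j ∧ B 3 = F k ∧
      x i (B.coord 2) * x j (B.coord 3) * x k (B.coord 1) =
        x i (B.coord 3) * x j (B.coord 1) * x k (B.coord 2))
    (i : ι) (a : Dual K (Fin 4 → K)) (ha : a (F i) = 0) (hane : ∀ j, j ≠ i → a (F j) ≠ 0)
    (hxa : x i a = 0) (w : Dual K (Fin 4 → K)) (hw : w (F i) = 0) (j k : ι) (hj : j ≠ i)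
    (hk : k ≠ i) (μ ν : Dual K (Fin 4 → K)) :
    x i w * (x j (μ - (μ (F j) / a (F j)) • a) * x k (ν - (ν (F k) / a (F k)) • a)) =
      x i w * (x j (ν - (ν (F j) / a (F j)) • a) * x k (μ - (μ (F k) / a (F k)) • a)) := by
  by_cases hjk : j = k
  · subst hjk; ring
  obtain ⟨B, hBi, hBj, hBk, ht⟩ := ht i j k hj.symm hk.symm hjk
  have hj0 := hane j hj
  have hk0 := hane k hk
  have e1 : x i (B.coord 0) * x j (B.coord 3) = x i (B.coord 3) * x j (B.coord 0) := by
    apply hb i j hj.symm <;> simp [← hBi, ← hBj]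
  have e2 : x i (B.coord 0) * x k (B.coord 2) = x i (B.coord 2) * x k (B.coord 0) := by
    apply hb i k hk.symm <;> simp [← hBi, ← hBk]
  have e3 : x j (B.coord 0) * x k (B.coord 1) = x j (B.coord 1) * x k (B.coord 0) := by
    apply hb j k hjk <;> simp [← hBj, ← hBk]
  have exj : ∀ μ : Dual K (Fin 4 → K), μ - (μ (F j) / a (F j)) • a =
      (μ (B 0) - (μ (F j) / a (F j)) * a (B 0)) • B.coord 0 + μ (F i) • B.coord 1 +
      (μ (F k) - (μ (F j) / a (F j)) * a (F k)) • B.coord 3 := by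
    intro μ
    conv_lhs => rw [dual_eq_sum_coord B (μ - (μ (F j) / a (F j)) • a)]
    simp [hBi, hBj, hBk, ha, hj0]
  have haB := dual_eq_sum_coord B a
  rw [hBi, hBj, hBk, ha] at haB
  -- The projections along `a` at `F j` and `F k` differ by a multiple of `a`. Hence the
  -- coefficients are those of `exj`, with the coordinate 3 replaced by its value modulo `a` in
  -- terms of the coordinates 0 and 2.
  have exk : ∀ μ : Dual K (Fin 4 → K), μ - (μ (F k) / a (F k)) • a =
      (μ (B 0) - (μ (F j) / a (F j)) * a (B 0)) • B.coord 0 + μ (F i) • B.coord 1 +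
      (μ (F k) - (μ (F j) / a (F j)) * a (F k)) •
        (-(a (F k))⁻¹) • (a (B 0) • B.coord 0 + a (F j) • B.coord 2) := by
    intro μ
    conv_lhs => rw [dual_eq_sum_coord B (μ - (μ (F k) / a (F k)) • a)]
    simp only [LinearMap.sub_apply, LinearMap.smul_apply, hBi, hBj, hBk, ha, smul_eq_mul]
    match_scalars <;> field_simp <;> ring
  rw [exj μ, exj ν, exk μ, exk ν]
  have hwB := dual_eq_sum_coord B w
  rw [hBi, hBj, hBk, hw] at hwB
  rw [hwB]
  rw [haB] at hxa
  have hr : algebraMap K Q (a (F k)) * algebraMap K Q (a (F k))⁻¹ = 1 := by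
    rw [← map_mul, mul_inv_cancel₀ hk0, map_one]
  simp only [map_add, map_smul, Algebra.smul_def, map_neg, map_zero, zero_mul, add_zero] at hxa ⊢
  generalize algebraMap K Q (a (F k))⁻¹ = r' at *
  generalize algebraMap K Q (a (F k)) = r at *
  generalize algebraMap K Q (a (F j)) = t at *
  generalize algebraMap K Q (a (B 0)) = s at *
  generalize algebraMap K Q (μ (B 0) - _) = a1 at *
  generalize algebraMap K Q (μ (F k) - _) = c1 at *
  generalize algebraMap K Q (ν (B 0) - _) = a2 at *
  generalize algebraMap K Q (ν (F k) - _) = c2 at *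
  generalize algebraMap K Q (μ (F i)) = b1 at *
  generalize algebraMap K Q (ν (F i)) = b2 at *
  generalize algebraMap K Q (w (B 0)) = w1 at *
  generalize algebraMap K Q (w (F j)) = w2 at *
  generalize algebraMap K Q (w (F k)) = w3 at *
  generalize x i (B.coord 0) = pi at *
  generalize x i (B.coord 2) = qji at *
  generalize x i (B.coord 3) = qki at *
  generalize x j (B.coord 0) = pj at *
  generalize x j (B.coord 1) = qij at *
  generalize x j (B.coord 3) = qkj at *
  generalize x k (B.coord 0) = pk at *
  generalize x k (B.coord 1) = qik at *
  generalize x k (B.coord 2) = qjk at *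
  -- Since a_i = 0, the i-th forms vanishing at `F i` are spanned by `pi` and `qji`. It suffices to
  -- kill the 2×2 minors of rows j and k after multiplication by these two; the trilinear relation
  -- enters only in `h4`.
  have hqki : qki = -r' * (s * pi + t * qji) := by linear_combination r' * hxa - qki * hr
  have h1 : pi * (pj * (-r' * (s * pk + t * qjk)) - qkj * pk) = 0 := by
    linear_combination -r' * t * pj * e2 - pk * e1 - pj * pk * hqki
  have h2 : qji * (pj * (-r' * (s * pk + t * qjk)) - qkj * pk) = 0 := by
    linear_combination (r' * s * pj+qkj) * e2 - qjk * e1 - qjk * pj * hqki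
  have h3 : pi * (qij * (-r' * (s * pk + t * qjk)) - qkj * qik) = 0 := by
    linear_combination -r' * t * qij * e2 - qik * e1 - qki * e3 - qij * pk * hqki
  have h4 : qji * (qij * (-r' * (s * pk + t * qjk)) - qkj * qik) = 0 := by
    linear_combination r' * s * qij * e2 - ht - qij * qjk * hqki
  have key1 : (w1 * pi + w2 * qji + w3 * qki) * (pj * (-r' * (s * pk + t * qjk)) - qkj * pk) = 0 := by
    rw [hqki]
    linear_combination (w1 - w3 * r' * s) * h1 + (w2 - w3 * r' * t) * h2
  have key2 : (w1 * pi + w2 * qji + w3 * qki) * (qij * (-r' * (s * pk + t * qjk)) - qkj * qik) = 0 := by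
    rw [hqki]
    linear_combination (w1 - w3 * r' * s) * h3 + (w2 - w3 * r' * t) * h4
  -- The difference of the two sides is alternating in μ, ν, so it is a combination of three minors.
  -- The last one is a bilinear relation between j and k and needs no multiplier.
  linear_combination (a1 * c2 - a2 * c1) * key1 + (b1 * c2 - b2 * c1) * key2 +
    (a1 * b2 - a2 * b1) * (w1 * pi + w2 * qji + w3 * qki) * e3

-- Membership by induction on the degree

attribute [local instance] MvPolynomial.weightedGradedAlgebra in
theorem weightedHomogeneousComponent_mul_of_left {ℓ g : CoordRing K n} {e v : Fin n → ℕ}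
    (hℓ : MvPolynomial.IsWeightedHomogeneous weights ℓ e) :
    MvPolynomial.weightedHomogeneousComponent weights (e + v) (ℓ * g) =
      ℓ * MvPolynomial.weightedHomogeneousComponent weights v g := by
  have := DirectSum.coe_decompose_mul_add_of_left_mem
    (MvPolynomial.weightedHomogeneousSubmodule K (weights (n := n))) (j := v) (b := g)
    ((MvPolynomial.mem_weightedHomogeneousSubmodule K weights e ℓ).2 hℓ)
  rw [← MvPolynomial.weightedDecomposition.decompose'_apply,
    ← MvPolynomial.weightedDecomposition.decompose'_apply]
  exact this

theorem isWeightedHomogeneous_aeval {f : CoordRing K n} {u : Fin n → ℕ}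
    (hf : MvPolynomial.IsWeightedHomogeneous weights f u) (z : Fin n × Fin 3 → CoordRing K n)
    (hz : ∀ q, MvPolynomial.IsWeightedHomogeneous weights (z q) (weights q)) :
    MvPolynomial.IsWeightedHomogeneous weights (MvPolynomial.aeval z f) u := by
  rw [MvPolynomial.aeval_def, MvPolynomial.eval₂_eq']
  refine MvPolynomial.IsWeightedHomogeneous.sum _ _ _ fun m hm => ?_
  rw [MvPolynomial.algebraMap_eq]
  refine MvPolynomial.IsWeightedHomogeneous.C_mul ?_ _
  have := MvPolynomial.IsWeightedHomogeneous.prod Finset.univ (fun q => z q ^ m q) _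
    fun q _ => (hz q).pow (m q)
  rw [← hf (MvPolynomial.mem_support_iff.1 hm), Finsupp.weight_apply,
    Finsupp.sum_fintype _ _ (by simp)]
  exact this

namespace Frame

variable {A : Fin n → Matrix (Fin 3) (Fin 4) K} (D : Frame A)

/-- The bilinear form attached to two linear forms vanishing at two focal points. -/
noncomputable def bilinear (i j : Fin n) (α β : Dual K (Fin 4 → K)) : CoordRing K n :=
  D.lift i α * D.lift j β - D.lift i β * D.lift j α

/-- The trilinear form attached to linear forms `a`, `b`, `c` that vanish at the `j`-th and `k`-th,
at the `i`-th and `k`-th, and at the `i`-th and `j`-th focal point. -/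
noncomputable def trilinear (i j k : Fin n) (a b c : Dual K (Fin 4 → K)) : CoordRing K n :=
  D.lift i b * D.lift j c * D.lift k a - D.lift i c * D.lift j a * D.lift k b

variable {J : Ideal (CoordRing K n)}

/-- Polynomials in the kernel of the pullback lie in `J` up to multiples of a generic linear form
on the `i`-th plane. -/
theorem mem_sup_span_of_pullback_eq_zero
    (hb : ∀ i j, i ≠ j → ∀ α β : Dual K (Fin 4 → K), α (D.focus i) = 0 → α (D.focus j) = 0 →
      β (D.focus i) = 0 → β (D.focus j) = 0 → D.bilinear i j α β ∈ J)
    (ht : ∀ i j k, i ≠ j → i ≠ k → j ≠ k → ∃ B : Basis (Fin 4) K (Fin 4 → K),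
      B 1 = D.focus i ∧ B 2 = D.focus j ∧ B 3 = D.focus k ∧
      D.trilinear i j k (B.coord 1) (B.coord 2) (B.coord 3) ∈ J)
    {f : CoordRing K n} {u : Fin n → ℕ} (hf : MvPolynomial.IsWeightedHomogeneous weights f u)
    (hf0 : pullback A f = 0) {i : Fin n} (hi : u i ≠ 0) {a : Dual K (Fin 4 → K)} (ha0 : a ≠ 0)
    (ha : a (D.focus i) = 0) (hane : ∀ j, j ≠ i → a (D.focus j) ≠ 0) :
    f ∈ J ⊔ Ideal.span {D.lift i a} := by
  classical
  obtain ⟨b, y, e, hby, hay, hy2, hexp⟩ := exists_adapted_coordinates (D.focus_ne_zero i) ha0 ha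
  have hb0 : b 0 (D.focus i) = 0 := by rw [← hy2, hby]; simp
  have hb1 : b 1 (D.focus i) = 0 := by rw [← hy2, hby]; simp
  let I := J ⊔ Ideal.span {D.lift i a}
  let mk : CoordRing K n →ₐ[K] CoordRing K n ⧸ I := Ideal.Quotient.mkₐ K I
  have hmk : ∀ g, g ∈ J → mk g = 0 := fun g hg =>
    Ideal.Quotient.eq_zero_iff_mem.2 (Ideal.mem_sup_left hg)
  let x : Fin n → Dual K (Fin 4 → K) →ₗ[K] CoordRing K n ⧸ I :=
    fun j => mk.toLinearMap ∘ₗ D.lift j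
  have hxa : x i a = 0 :=
    Ideal.Quotient.eq_zero_iff_mem.2 (Ideal.mem_sup_right (Ideal.mem_span_singleton_self _))
  have hbx : ∀ i j, i ≠ j → ∀ α β : Dual K (Fin 4 → K), α (D.focus i) = 0 → α (D.focus j) = 0 →
      β (D.focus i) = 0 → β (D.focus j) = 0 → x i α * x j β = x i β * x j α := by
    intro i j hij α β h1 h2 h3 h4
    have := hmk _ (hb i j hij α β h1 h2 h3 h4)
    rw [bilinear, map_sub, map_mul, map_mul, sub_eq_zero] at this
    exact this
  have htx : ∀ i j k, i ≠ j → i ≠ k → j ≠ k → ∃ B : Basis (Fin 4) K (Fin 4 → K),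
      B 1 = D.focus i ∧ B 2 = D.focus j ∧ B 3 = D.focus k ∧
      x i (B.coord 2) * x j (B.coord 3) * x k (B.coord 1) =
        x i (B.coord 3) * x j (B.coord 1) * x k (B.coord 2) := by
    intro i j k hij hik hjk
    obtain ⟨B, h1, h2, h3, h⟩ := ht i j k hij hik hjk
    have := hmk _ h
    rw [trilinear, map_sub, map_mul, map_mul, map_mul, map_mul, sub_eq_zero] at this
    exact ⟨B, h1, h2, h3, this⟩
  -- New coordinates on each image plane. For j ≠ i each plane coordinate `b d` is corrected by a
  -- multiple of `a` so that it vanishes at the j-th focus. Camera i only sees `b 0`, `b 1` and `a`,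
  -- since `b 2` is 1 at its focus.
  let form : Fin n × Fin 3 → Dual K (Fin 4 → K) := fun q =>
    if q.1 = i then ![b 0, b 1, a] q.2
    else b q.2 - (b q.2 (D.focus q.1) / a (D.focus q.1)) • a
  let z : Fin n × Fin 3 → CoordRing K n := fun q => D.lift q.1 (form q)
  let dir : Fin n × Fin 3 → Fin 4 → K := fun q => if q = (i, 2) then e else y q.2
  let zinv : Fin n × Fin 3 → CoordRing K n := fun q =>
    ∑ d, row (A q.1) q.2 (dir (q.1, d)) • MvPolynomial.X (q.1, d)
  have hzinv : ∀ q, MvPolynomial.aeval z (zinv q) = MvPolynomial.X q := by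
    rintro ⟨j, c⟩
    have hrow : row (A j) c = ∑ d, row (A j) c (dir (j, d)) • form (j, d) := by
      have h := hexp (row (A j) c)
      by_cases hj : j = i
      · subst hj
        rw [Fin.sum_univ_three] at h
        simp only [hy2, D.row_focus, zero_smul, add_zero] at h
        simpa [form, dir, Fin.sum_univ_three] using h
      · have h0 := LinearMap.congr_fun h (D.focus j)
        rw [D.row_focus] at h0
        have haj := hane j hj
        simp only [form, dir, hj, Prod.mk.injEq, false_and, if_false, smul_sub, smul_smul,
          Finset.sum_sub_distrib, ← Finset.sum_smul]
        -- Evaluating the expansion of the row at the j-th focus, where the row vanishes, shows that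
        -- the corrections add up to exactly its `a`-term.
        have h1 : ∑ d, row (A j) c (y d) * (b d (D.focus j) / a (D.focus j)) =
            - row (A j) c e := by
          simp only [LinearMap.add_apply, LinearMap.sum_apply, LinearMap.smul_apply,
            smul_eq_mul] at h0
          simp only [← mul_div_assoc]
          rw [← Finset.sum_div, div_eq_iff haj]
          linear_combination -h0
        rw [h1, neg_smul, sub_neg_eq_add]
        exact h
    conv_rhs => rw [← D.lift_row]
    rw [hrow]
    simp only [zinv, map_sum, map_smul, MvPolynomial.aeval_X, z]
  have hf' : MvPolynomial.aeval z (MvPolynomial.aeval zinv f) = f := by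
    have : (MvPolynomial.aeval z).comp (MvPolynomial.aeval zinv) = AlgHom.id K (CoordRing K n) := by
      refine MvPolynomial.algHom_ext fun q => ?_
      rw [AlgHom.comp_apply, MvPolynomial.aeval_X, hzinv]; rfl
    exact AlgHom.congr_fun this f
  have hmem : mk f = 0 := by
    rw [← hf', ← AlgHom.comp_apply, MvPolynomial.comp_aeval]
    refine aeval_eq_zero_of_column_specialization i _ ?_ ?_ ?_ _ (Finsupp.equivFunOnFinite.symm u)
      hi ?_ ?_
    · have : form (i, 2) = a := by simp [form]
      simp only [z, this]
      exact hxa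
    -- The corrected forms (j, 0) and (j, 1) vanish at both foci, so the bilinear relation applies;
    -- on the i-th plane the corrections disappear because a_i = 0.
    · intro j hj
      have h0 : form (i, 0) = b 0 := by simp [form]
      have h1 : form (i, 1) = b 1 := by simp [form]
      have hj' : ∀ d, form (j, d) = b d - (b d (D.focus j) / a (D.focus j)) • a := by
        intro d; simp [form, hj]
      have haj := hane j hj
      have := hbx i j hj.symm (form (j, 0)) (form (j, 1)) (by simp [hj', hb0, ha])
        (by simp [hj', haj]) (by simp [hj', hb1, ha]) (by simp [hj', haj])
      have e0 : ∀ d, x i (form (j, d)) = x i (b d) := by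
        intro d
        rw [hj', map_sub, map_smul, hxa, smul_zero, sub_zero]
      rw [e0, e0, ← h0, ← h1] at this
      exact this
    · intro c hc j k hj hk d d'
      have hj' : ∀ d, form (j, d) = b d - (b d (D.focus j) / a (D.focus j)) • a := by
        intro d; simp [form, hj]
      have hk' : ∀ d, form (k, d) = b d - (b d (D.focus k) / a (D.focus k)) • a := by
        intro d; simp [form, hk]
      have hcF : form (i, c) (D.focus i) = 0 := by
        fin_cases c
        · simpa [form] using hb0
        · simpa [form] using hb1
        · exact absurd rfl hc
      have := mul_swap_of_generic D.focus x hbx htx i a ha hane hxa _ hcF j k hj hk (b d) (b d')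
      rw [← hj', ← hk', ← hj', ← hk'] at this
      exact this
    · intro m hm
      have hhom : MvPolynomial.IsWeightedHomogeneous weights (MvPolynomial.aeval zinv f) u := by
        refine isWeightedHomogeneous_aeval hf zinv fun q => ?_
        refine MvPolynomial.IsWeightedHomogeneous.sum _ _ _ fun d _ => ?_
        rw [MvPolynomial.smul_eq_C_mul]
        exact (MvPolynomial.isWeightedHomogeneous_X K weights (q.1, d)).C_mul _
      have := hhom (MvPolynomial.mem_support_iff.1 hm)
      rw [weight_weights_eq_mapDomain] at this
      exact DFunLike.coe_injective this
    -- Column specialization in the new coordinates is the pullback followed by restriction to the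
    -- plane a = 0 with basis `y`. Setting (i, 2) to 0 is consistent, since the rows of camera i
    -- vanish at `y 2`, its focus.
    · let π : MvPolynomial (Fin 4) K →ₐ[K] MvPolynomial (Fin 3) K :=
        MvPolynomial.aeval fun c => ∑ d, y d c • MvPolynomial.X d
      have hπ : ∀ w, π (linPoly w) = ∑ d, w (y d) • MvPolynomial.X d := by
        intro w
        rw [linPoly_apply, map_sum]
        simp only [map_smul, π, MvPolynomial.aeval_X, Finset.smul_sum]
        rw [Finset.sum_comm]
        refine Finset.sum_congr rfl fun d _ => ?_
        rw [LinearMap.pi_apply_eq_sum_univ w (y d), Finset.sum_smul]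
        refine Finset.sum_congr rfl fun c _ => ?_
        rw [smul_smul, smul_eq_mul, mul_comm]
        congr 3
        ext c'; simp [Pi.single_apply, eq_comm]
      have : (MvPolynomial.aeval (fun q : Fin n × Fin 3 =>
          if q = (i, 2) then 0 else (MvPolynomial.X q.2 : MvPolynomial (Fin 3) K))).comp
          (MvPolynomial.aeval zinv) = π.comp (pullback A) := by
        refine MvPolynomial.algHom_ext fun q => ?_
        rw [AlgHom.comp_apply, AlgHom.comp_apply, MvPolynomial.aeval_X, pullback,
          MvPolynomial.aeval_X, hπ]
        simp only [zinv, map_sum, map_smul, MvPolynomial.aeval_X]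
        refine Finset.sum_congr rfl fun d _ => ?_
        by_cases hq : (q.1, d) = (i, 2)
        · obtain ⟨h1, rfl⟩ := Prod.mk.inj hq
          rw [if_pos hq, smul_zero, hy2, ← h1, D.row_focus, zero_smul]
        · simp only [dir, if_neg hq]
      have := AlgHom.congr_fun this f
      rw [AlgHom.comp_apply, AlgHom.comp_apply, hf0, map_zero] at this
      exact this
  exact Ideal.Quotient.eq_zero_iff_mem.1 hmem

/-- Dividing by a generic form lowers the degree: modulo `J` the polynomial is a multiple of a_i,
and the cofactor may be replaced by its homogeneous component, whose pullback is zero because that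
of a_i is not. In degree zero the pullback is injective. -/
theorem mem_of_pullback_eq_zero [Infinite K] (hA : LinearlyGeneralPosition A)
    (hJ : ∀ f ∈ J, ∀ u, MvPolynomial.weightedHomogeneousComponent weights u f ∈ J)
    (hJ0 : ∀ f ∈ J, pullback A f = 0)
    (hb : ∀ i j, i ≠ j → ∀ α β : Dual K (Fin 4 → K), α (D.focus i) = 0 → α (D.focus j) = 0 →
      β (D.focus i) = 0 → β (D.focus j) = 0 → D.bilinear i j α β ∈ J)
    (ht : ∀ i j k, i ≠ j → i ≠ k → j ≠ k → ∃ B : Basis (Fin 4) K (Fin 4 → K),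
      B 1 = D.focus i ∧ B 2 = D.focus j ∧ B 3 = D.focus k ∧
      D.trilinear i j k (B.coord 1) (B.coord 2) (B.coord 3) ∈ J)
    {f : CoordRing K n} {u : Fin n → ℕ} (hf : MvPolynomial.IsWeightedHomogeneous weights f u)
    (hf0 : pullback A f = 0) : f ∈ J := by
  induction hN : ∑ i, u i generalizing u f with
  | zero =>
    have hu : ∀ i, u i = 0 := by simpa using hN
    have hC : f = MvPolynomial.C (f.coeff 0) := by
      ext m
      rw [MvPolynomial.coeff_C]
      split_ifs with h
      · rw [h]
      · by_contra hm
        apply h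
        have hw := hf hm
        ext ⟨i, c⟩
        have := weight_weights m i
        rw [hw, hu, eq_comm, Finset.sum_eq_zero_iff] at this
        exact (this c (Finset.mem_univ c)).symm
    rw [hC, ← MvPolynomial.algebraMap_eq, AlgHom.commutes, MvPolynomial.algebraMap_eq,
      MvPolynomial.C_eq_zero] at hf0
    rw [hC, hf0, map_zero]
    exact J.zero_mem
  | succ N ih =>
    obtain ⟨i, hi⟩ : ∃ i, u i ≠ 0 := by
      by_contra! h
      simp [h] at hN
    obtain ⟨a, ha0, ha, hane⟩ := D.exists_generic_form hA i
    have hmem := D.mem_sup_span_of_pullback_eq_zero hb ht hf hf0 hi ha0 ha hane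
    obtain ⟨p, hp, q, hq, rfl⟩ := Submodule.mem_sup.1 hmem
    obtain ⟨g, rfl⟩ := Ideal.mem_span_singleton.1 hq
    have hu : u = Pi.single i 1 + (u - Pi.single i 1) := by
      ext j
      by_cases hj : j = i
      · subst hj; simp; omega
      · simp [hj]
    have hfu := MvPolynomial.IsWeightedHomogeneous.weightedHomogeneousComponent_same hf
    rw [map_add] at hfu
    conv at hfu => lhs; arg 2; rw [hu]
    rw [weightedHomogeneousComponent_mul_of_left (D.isWeightedHomogeneous_lift i a)] at hfu
    have hpu := hJ p hp u
    rw [← hfu] at hf0 ⊢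
    refine J.add_mem hpu (J.mul_mem_left _ (ih
      (MvPolynomial.weightedHomogeneousComponent_isWeightedHomogeneous (u - Pi.single i 1) g)
      ?_ ?_))
    · rw [map_add, hJ0 _ hpu, zero_add, map_mul, D.pullback_lift i a ha] at hf0
      exact (mul_eq_zero.1 hf0).resolve_left (linPoly_ne_zero ha0)
    · have : ∑ j, u j = ∑ j, (Pi.single i 1 + (u - Pi.single i 1) : Fin n → ℕ) j := by rw [← hu]
      have h1 : ∑ j, (Pi.single i 1 : Fin n → ℕ) j = 1 := by simp [Pi.single_apply]
      simp only [Pi.add_apply, Finset.sum_add_distrib] at this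
      omega

end Frame

/-! ### Separating curves and the number of generators -/

/-- Restriction of a polynomial to a curve `T ↦ (A₁ v₁ T, …, Aₙ vₙ T)`. -/
noncomputable def slice (A : Fin n → Matrix (Fin 3) (Fin 4) K) (v : Fin n → Fin 4 → K) :
    CoordRing K n →ₐ[K] Polynomial K :=
  MvPolynomial.aeval fun q => row (A q.1) q.2 (v q.1) • Polynomial.X

theorem coeff_zero_slice (A : Fin n → Matrix (Fin 3) (Fin 4) K) (v : Fin n → Fin 4 → K)
    (h : CoordRing K n) : (slice A v h).coeff 0 = MvPolynomial.constantCoeff h := by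
  have : (Polynomial.constantCoeff.comp (slice A v).toRingHom) = MvPolynomial.constantCoeff := by
    refine MvPolynomial.ringHom_ext (fun r => ?_) fun q => ?_
    · simp [slice]
    · simp [slice]
  exact RingHom.congr_fun this h

theorem coord_basis (B : Basis (Fin 4) K (Fin 4 → K)) (d d' : Fin 4) :
    B.coord d (B d') = if d' = d then 1 else 0 := by
  rw [Basis.coord_apply, Basis.repr_self, Finsupp.single_apply]

/-- Polynomials separated by ring homomorphisms of this kind are linearly independent modulo the
irrelevant ideal, so that they cannot be replaced by fewer generators. -/
theorem card_le_of_separating {ι σ : Type*} [DecidableEq ι] (I : Finset ι)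
    (g : ι → MvPolynomial σ K)
    (ε : ι → MvPolynomial σ K →ₐ[K] Polynomial K) (d : ι → ℕ)
    (hε : ∀ i ∈ I, ∀ h, (ε i h).coeff 0 = MvPolynomial.constantCoeff h)
    (hg : ∀ i ∈ I, ε i (g i) = Polynomial.X ^ d i)
    (hne : ∀ i ∈ I, ∀ j ∈ I, j ≠ i → ε i (g j) = 0)
    (H : Finset (MvPolynomial σ K))
    (hH : Ideal.span (H : Set (MvPolynomial σ K)) = Ideal.span (g '' I)) : I.card ≤ H.card := by
  classical
  let Λ : MvPolynomial σ K →ₗ[K] (I → K) :=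
    LinearMap.pi fun i => Polynomial.lcoeff K (d i) ∘ₗ (ε i).toLinearMap
  have hΛ : ∀ f i, Λ f i = (ε i f).coeff (d i) := fun f i => rfl
  have hdiv : ∀ f ∈ Ideal.span (g '' I), ∀ i ∈ I, Polynomial.X ^ d i ∣ ε i f := by
    intro f hf i hi
    have : Ideal.span (g '' I) ≤ (Ideal.span {Polynomial.X ^ d i}).comap (ε i) := by
      rw [Ideal.span_le]
      rintro _ ⟨j, hj, rfl⟩
      rw [SetLike.mem_coe, Ideal.mem_comap, Ideal.mem_span_singleton]
      by_cases h : j = i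
      · subst h; rw [hg j hi]
      · rw [hne i hi j hj h]; exact dvd_zero _
    exact Ideal.mem_span_singleton.1 (this hf)
  -- On the ideal each `ε i f` starts in degree at least `d i`, so only the constant term of the
  -- multiplier reaches the coefficient read off by `Λ`. Thus `Λ` kills 𝔪 times the ideal, and the
  -- images of any generating set span.
  have hmul : ∀ f ∈ Ideal.span (g '' I), ∀ h, Λ (h * f) = MvPolynomial.constantCoeff h • Λ f := by
    intro f hf h
    ext ⟨i, hi⟩
    obtain ⟨q, hq⟩ := hdiv f hf i hi
    rw [Pi.smul_apply, hΛ, hΛ, map_mul, hq, mul_left_comm, smul_eq_mul, ← hε i hi]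
    have := Polynomial.coeff_X_pow_mul (ε i h * q) (d i) 0
    have h2 := Polynomial.coeff_X_pow_mul q (d i) 0
    rw [zero_add] at this h2
    dsimp only
    rw [this, h2, Polynomial.mul_coeff_zero]
  have hspan : ∀ f ∈ Ideal.span (H : Set (MvPolynomial σ K)),
      Λ f ∈ Submodule.span K ((H.image Λ : Finset (I → K)) : Set (I → K)) := by
    intro f hf
    induction hf using Submodule.span_induction with
    | mem x hx => exact Submodule.subset_span (Finset.mem_coe.2 (Finset.mem_image_of_mem _ hx))
    | zero => rw [map_zero]; exact Submodule.zero_mem _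
    | add x y _ _ hx hy => rw [map_add]; exact Submodule.add_mem _ hx hy
    | smul c x hx ih =>
      rw [smul_eq_mul, hmul x (hH ▸ hx)]
      exact Submodule.smul_mem _ _ ih
  have htop : Submodule.span K ((H.image Λ : Finset (I → K)) : Set (I → K)) = ⊤ := by
    rw [eq_top_iff, ← (Pi.basisFun K I).span_eq, Submodule.span_le]
    rintro _ ⟨i, rfl⟩
    have : Pi.basisFun K I i = Λ (g i) := by
      ext j
      rw [hΛ, Pi.basisFun_apply, Pi.single_apply]
      split_ifs with h
      · rw [h, hg i i.2]; simp
      · rw [hne j j.2 i i.2 fun e => h (Subtype.ext e.symm)]; simp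
    rw [this]
    exact hspan _ (by rw [hH]; exact Ideal.subset_span ⟨i, i.2, rfl⟩)
  have h1 := finrank_span_finset_le_card (R := K) (H.image Λ)
  rw [Set.finrank, htop, finrank_top, finrank_fintype_fun_eq_card, Fintype.card_coe] at h1
  exact h1.trans Finset.card_image_le

namespace Frame

variable {A : Fin n → Matrix (Fin 3) (Fin 4) K} (D : Frame A)

theorem slice_lift (v : Fin n → Fin 4 → K) (i : Fin n) (w : Dual K (Fin 4 → K))
    (hw : w (D.focus i) = 0) : slice A v (D.lift i w) = w (v i) • Polynomial.X :=
  D.aeval_lift _ i (LinearMap.toSpanSingleton K _ Polynomial.X ∘ₗ Dual.eval K (Fin 4 → K) (v i))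
    (fun _ => rfl) w hw

theorem slice_bilinear (v : Fin n → Fin 4 → K) {i j : Fin n} {α β : Dual K (Fin 4 → K)}
    (h1 : α (D.focus i) = 0) (h2 : α (D.focus j) = 0) (h3 : β (D.focus i) = 0)
    (h4 : β (D.focus j) = 0) :
    slice A v (D.bilinear i j α β) =
      (α (v i) * β (v j) - β (v i) * α (v j)) • Polynomial.X ^ 2 := by
  rw [bilinear, map_sub, map_mul, map_mul, D.slice_lift v i α h1, D.slice_lift v i β h3,
    D.slice_lift v j α h2, D.slice_lift v j β h4]
  simp only [Polynomial.smul_eq_C_mul, map_sub, map_mul]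
  ring

theorem slice_trilinear (v : Fin n → Fin 4 → K) {i j k : Fin n} {a b c : Dual K (Fin 4 → K)}
    (h1 : a (D.focus j) = 0) (h2 : a (D.focus k) = 0) (h3 : b (D.focus i) = 0)
    (h4 : b (D.focus k) = 0) (h5 : c (D.focus i) = 0) (h6 : c (D.focus j) = 0) :
    slice A v (D.trilinear i j k a b c) =
      (b (v i) * c (v j) * a (v k) - c (v i) * a (v j) * b (v k)) • Polynomial.X ^ 3 := by
  rw [trilinear, map_sub, map_mul, map_mul, map_mul, map_mul, D.slice_lift v i b h3,
    D.slice_lift v i c h5, D.slice_lift v j a h1, D.slice_lift v j c h6, D.slice_lift v k a h2,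
    D.slice_lift v k b h4]
  simp only [Polynomial.smul_eq_C_mul, map_sub, map_mul]
  ring

theorem pullback_bilinear {i j : Fin n} {α β : Dual K (Fin 4 → K)}
    (h1 : α (D.focus i) = 0) (h2 : α (D.focus j) = 0) (h3 : β (D.focus i) = 0)
    (h4 : β (D.focus j) = 0) : pullback A (D.bilinear i j α β) = 0 := by
  rw [bilinear, map_sub, map_mul, map_mul, D.pullback_lift i α h1, D.pullback_lift i β h3,
    D.pullback_lift j α h2, D.pullback_lift j β h4]
  ring

theorem pullback_trilinear {i j k : Fin n} {a b c : Dual K (Fin 4 → K)}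
    (h1 : a (D.focus j) = 0) (h2 : a (D.focus k) = 0) (h3 : b (D.focus i) = 0)
    (h4 : b (D.focus k) = 0) (h5 : c (D.focus i) = 0) (h6 : c (D.focus j) = 0) :
    pullback A (D.trilinear i j k a b c) = 0 := by
  rw [trilinear, map_sub, map_mul, map_mul, map_mul, map_mul, D.pullback_lift i b h3,
    D.pullback_lift i c h5, D.pullback_lift j a h1, D.pullback_lift j c h6, D.pullback_lift k a h2,
    D.pullback_lift k b h4]
  ring

theorem isMultilinear_bilinear {i j : Fin n} (hij : i ≠ j) (α β : Dual K (Fin 4 → K)) :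
    IsMultilinear (D.bilinear i j α β) {i, j} := by
  have h := fun α β => (D.isWeightedHomogeneous_lift i α).mul (D.isWeightedHomogeneous_lift j β)
  have hdeg : (fun l => if l ∈ ({i, j} : Finset (Fin n)) then 1 else 0) =
      (Pi.single i 1 + Pi.single j 1 : Fin n → ℕ) := by
    ext l
    by_cases h1 : l = i <;> by_cases h2 : l = j <;> simp_all
  rw [IsMultilinear, isMultihomogeneous_iff, hdeg]
  exact (h α β).sub (h β α)

theorem isMultilinear_trilinear {i j k : Fin n} (hij : i ≠ j) (hik : i ≠ k) (hjk : j ≠ k)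
    (a b c : Dual K (Fin 4 → K)) : IsMultilinear (D.trilinear i j k a b c) {i, j, k} := by
  have h := fun a b c => ((D.isWeightedHomogeneous_lift i a).mul
    (D.isWeightedHomogeneous_lift j b)).mul (D.isWeightedHomogeneous_lift k c)
  have hdeg : (fun l => if l ∈ ({i, j, k} : Finset (Fin n)) then 1 else 0) =
      (Pi.single i 1 + Pi.single j 1 + Pi.single k 1 : Fin n → ℕ) := by
    ext l
    by_cases h1 : l = i <;> by_cases h2 : l = j <;> by_cases h3 : l = k <;> simp_all
  rw [IsMultilinear, isMultihomogeneous_iff, hdeg]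
  exact (h b c a).sub (h c a b)

/-! ### Generators attached to pairs and triples of cameras -/

/-- The bilinear generator attached to two cameras. -/
def IsBilinearGenerator (σ : Finset (Fin n)) (g : CoordRing K n) : Prop :=
  ∃ i j, i ≠ j ∧ σ = {i, j} ∧ ∃ B : Basis (Fin 4) K (Fin 4 → K),
    B 2 = D.focus i ∧ B 3 = D.focus j ∧ g = D.bilinear i j (B.coord 0) (B.coord 1)

/-- The trilinear generator attached to three cameras. -/
def IsTrilinearGenerator (σ : Finset (Fin n)) (g : CoordRing K n) : Prop :=
  ∃ i j k, i ≠ j ∧ i ≠ k ∧ j ≠ k ∧ σ = {i, j, k} ∧ ∃ B : Basis (Fin 4) K (Fin 4 → K),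
    B 1 = D.focus i ∧ B 2 = D.focus j ∧ B 3 = D.focus k ∧
    g = D.trilinear i j k (B.coord 1) (B.coord 2) (B.coord 3)

variable {D} {σ τ : Finset (Fin n)} {g : CoordRing K n}

theorem IsBilinearGenerator.card (h : D.IsBilinearGenerator σ g) : σ.card = 2 := by
  obtain ⟨i, j, hij, rfl, -⟩ := h
  exact Finset.card_pair hij

theorem IsTrilinearGenerator.card (h : D.IsTrilinearGenerator σ g) : σ.card = 3 := by
  obtain ⟨i, j, k, hij, hik, hjk, rfl, -⟩ := h
  exact Finset.card_eq_three.2 ⟨i, j, k, hij, hik, hjk, rfl⟩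

theorem IsBilinearGenerator.isMultilinear (h : D.IsBilinearGenerator σ g) :
    IsMultilinear g σ := by
  obtain ⟨i, j, hij, rfl, B, -, -, rfl⟩ := h
  exact D.isMultilinear_bilinear hij _ _

theorem IsTrilinearGenerator.isMultilinear (h : D.IsTrilinearGenerator σ g) :
    IsMultilinear g σ := by
  obtain ⟨i, j, k, hij, hik, hjk, rfl, B, -, -, -, rfl⟩ := h
  exact D.isMultilinear_trilinear hij hik hjk _ _ _

theorem IsBilinearGenerator.pullback_eq_zero (h : D.IsBilinearGenerator σ g) :
    pullback A g = 0 := by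
  obtain ⟨i, j, hij, rfl, B, h2, h3, rfl⟩ := h
  apply D.pullback_bilinear <;> simp [← h2, ← h3]

theorem IsTrilinearGenerator.pullback_eq_zero (h : D.IsTrilinearGenerator σ g) :
    pullback A g = 0 := by
  obtain ⟨i, j, k, hij, hik, hjk, rfl, B, h1, h2, h3, rfl⟩ := h
  apply D.pullback_trilinear <;> simp [← h1, ← h2, ← h3]

variable (D) in
theorem exists_isBilinearGenerator (hA : LinearlyGeneralPosition A) (hσ : σ.card = 2) :
    ∃ g, D.IsBilinearGenerator σ g := by
  obtain ⟨i, j, hij, rfl⟩ := Finset.card_eq_two.1 hσ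
  obtain ⟨B, h2, h3⟩ := exists_basis_of_linearIndependent_two (D.linearIndependent_pair hA hij)
  exact ⟨_, i, j, hij, rfl, B, h2, h3, rfl⟩

variable (D) in
theorem exists_isTrilinearGenerator (hA : LinearlyGeneralPosition A) (hσ : σ.card = 3) :
    ∃ g, D.IsTrilinearGenerator σ g := by
  obtain ⟨i, j, k, hij, hik, hjk, rfl⟩ := Finset.card_eq_three.1 hσ
  obtain ⟨B, h1, h2, h3⟩ := exists_basis_of_linearIndependent_three
    (D.linearIndependent_triple hA hij hik hjk)
  exact ⟨_, i, j, k, hij, hik, hjk, rfl, B, h1, h2, h3, rfl⟩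

theorem IsBilinearGenerator.slice_eq_zero (h : D.IsBilinearGenerator σ g)
    {v : Fin n → Fin 4 → K} {l : Fin n} (hl : l ∈ σ) (hv : v l = 0) : slice A v g = 0 := by
  obtain ⟨i, j, hij, rfl, B, h2, h3, rfl⟩ := h
  rw [D.slice_bilinear]
  · simp only [Finset.mem_insert, Finset.mem_singleton] at hl
    rcases hl with rfl | rfl <;> simp [hv]
  all_goals simp [← h2, ← h3]

theorem IsTrilinearGenerator.slice_eq_zero (h : D.IsTrilinearGenerator σ g)
    {v : Fin n → Fin 4 → K} {l : Fin n} (hl : l ∈ σ) (hv : v l = 0) : slice A v g = 0 := by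
  obtain ⟨i, j, k, hij, hik, hjk, rfl, B, h1, h2, h3, rfl⟩ := h
  rw [D.slice_trilinear]
  · simp only [Finset.mem_insert, Finset.mem_singleton] at hl
    rcases hl with rfl | rfl | rfl <;> simp [hv]
  all_goals simp [← h1, ← h2, ← h3]

variable (D) in
/-- The generator attached to two or three cameras. -/
def IsGenerator (σ : Finset (Fin n)) (g : CoordRing K n) : Prop :=
  D.IsBilinearGenerator σ g ∨ D.IsTrilinearGenerator σ g

theorem IsGenerator.slice_eq_zero (h : D.IsGenerator σ g)
    {v : Fin n → Fin 4 → K} {l : Fin n} (hl : l ∈ σ) (hv : v l = 0) : slice A v g = 0 :=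
  h.elim (fun h => h.slice_eq_zero hl hv) fun h => h.slice_eq_zero hl hv

theorem IsGenerator.exists_separating_slice (h : D.IsGenerator σ g) :
    ∃ (v : Fin n → Fin 4 → K) (d : ℕ), slice A v g = Polynomial.X ^ d ∧
      ∀ τ g', D.IsGenerator τ g' → τ ≠ σ → slice A v g' = 0 := by
  rcases h with h | h
  · have hcard := h.card
    obtain ⟨i, j, hij, rfl, B, h2, h3, rfl⟩ := h
    -- B 0 and B 1 are dual to the two forms, so the coefficient is a determinant equal to 1. A
    -- generator for any other set involves a camera outside the pair, where the curve is zero.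
    refine ⟨fun l => if l = i then B 0 else if l = j then B 1 else 0, 2, ?_, ?_⟩
    · rw [D.slice_bilinear]
      · simp [hij.symm]
      all_goals simp [← h2, ← h3]
    · intro τ g' hg' hne
      obtain ⟨l, hl, hl'⟩ : ∃ l ∈ τ, l ∉ ({i, j} : Finset (Fin n)) := by
        by_contra! hsub
        refine hne (Finset.eq_of_subset_of_card_le hsub ?_)
        rw [hcard]
        rcases hg' with h | h <;> rw [h.card]
        omega
      refine hg'.slice_eq_zero hl ?_
      simp only [Finset.mem_insert, Finset.mem_singleton, not_or] at hl'
      simp [hl'.1, hl'.2]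
  · have hcard := h.card
    obtain ⟨i, j, k, hij, hik, hjk, rfl, B, h1, h2, h3, rfl⟩ := h
    -- A cyclic shift of the foci: the first product of the trilinear form becomes 1 and the second
    -- 0. In every pair inside the triple one camera receives the focus of the other, where both
    -- forms of the pencil vanish, so bilinear generators vanish too.
    refine ⟨fun l => if l = i then D.focus j else if l = j then D.focus k else
      if l = k then D.focus i else 0, 3, ?_, ?_⟩
    · rw [D.slice_trilinear]
      · simp [hij.symm, hik.symm, hjk.symm, ← h1, ← h2, ← h3]
      all_goals simp [← h1, ← h2, ← h3]
    · intro τ g' hg' hne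
      by_cases hsub : τ ⊆ {i, j, k}
      · rcases hg' with hg' | hg'
        · obtain ⟨i', j', hij', rfl, B', h2', h3', rfl⟩ := hg'
          have hc : ∀ d : Fin 4, d ≠ 2 → d ≠ 3 → B'.coord d (D.focus i') = 0 ∧
              B'.coord d (D.focus j') = 0 := by
            intro d hd2 hd3
            rw [← h2', ← h3', coord_basis, coord_basis, if_neg hd2.symm, if_neg hd3.symm]
            exact ⟨rfl, rfl⟩
          obtain ⟨a1, a2⟩ := hc 0 (by decide) (by decide)
          obtain ⟨b1, b2⟩ := hc 1 (by decide) (by decide)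
          rw [D.slice_bilinear _ a1 a2 b1 b2]
          have hi' : i' ∈ ({i, j, k} : Finset (Fin n)) := hsub (by simp)
          have hj' : j' ∈ ({i, j, k} : Finset (Fin n)) := hsub (by simp)
          simp only [Finset.mem_insert, Finset.mem_singleton] at hi' hj'
          rcases hi' with rfl | rfl | rfl <;> rcases hj' with rfl | rfl | rfl <;>
            first
            | exact absurd rfl hij'
            | simp [hij.symm, hik.symm, hjk.symm, a1, a2, b1, b2, -Basis.coord_apply]
        · exact absurd (Finset.eq_of_subset_of_card_le hsub (by rw [hcard, hg'.card])) hne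
      · obtain ⟨l, hl, hl'⟩ := Finset.not_subset.1 hsub
        refine hg'.slice_eq_zero hl ?_
        simp only [Finset.mem_insert, Finset.mem_singleton, not_or] at hl'
        simp [hl'.1, hl'.2.1, hl'.2.2]

variable {J : Ideal (CoordRing K n)}

/-- The bilinear form is alternating in α, β, and the forms through both foci make up a
2-dimensional space. Another choice only multiplies the generator by a determinant. -/
theorem IsBilinearGenerator.bilinear_mem {i j : Fin n} (h : D.IsBilinearGenerator {i, j} g)
    (hg : g ∈ J) {α β : Dual K (Fin 4 → K)} (h1 : α (D.focus i) = 0) (h2 : α (D.focus j) = 0)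
    (h3 : β (D.focus i) = 0) (h4 : β (D.focus j) = 0) : D.bilinear i j α β ∈ J := by
  obtain ⟨i', j', hij, hσ, B, hB2, hB3, rfl⟩ := h
  have key : ∀ α β : Dual K (Fin 4 → K), α (D.focus i') = 0 → α (D.focus j') = 0 →
      β (D.focus i') = 0 → β (D.focus j') = 0 → D.bilinear i' j' α β ∈ J := by
    intro α β h1 h2 h3 h4
    have e1 := dual_eq_sum_coord B α
    have e2 := dual_eq_sum_coord B β
    rw [hB2, hB3, h1, h2, zero_smul, zero_smul, add_zero, add_zero] at e1
    rw [hB2, hB3, h3, h4, zero_smul, zero_smul, add_zero, add_zero] at e2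
    have : D.bilinear i' j' α β = MvPolynomial.C (α (B 0) * β (B 1) - α (B 1) * β (B 0)) *
        D.bilinear i' j' (B.coord 0) (B.coord 1) := by
      conv_lhs => rw [e1, e2]
      simp only [bilinear, map_add, map_smul, MvPolynomial.smul_eq_C_mul, map_sub, map_mul]
      ring
    rw [this]
    exact J.mul_mem_left _ hg
  have hi : i' ∈ ({i, j} : Finset (Fin n)) := hσ ▸ by simp
  have hj : j' ∈ ({i, j} : Finset (Fin n)) := hσ ▸ by simp
  simp only [Finset.mem_insert, Finset.mem_singleton] at hi hj
  rcases hi with rfl | rfl <;> rcases hj with rfl | rfl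
  · exact absurd rfl hij
  · exact key α β h1 h2 h3 h4
  · have := key β α h4 h3 h2 h1
    rw [bilinear] at this ⊢
    rwa [mul_comm, mul_comm (D.lift i' α)] at this
  · exact absurd rfl hij

/-- Reordering the cameras together with the basis changes the trilinear form only by a sign, so a
generator for the unordered triple serves every ordering. Two adjacent transpositions suffice. -/
theorem IsTrilinearGenerator.exists_trilinear_mem {i j k : Fin n} (hij : i ≠ j) (hik : i ≠ k)
    (hjk : j ≠ k) (h : D.IsTrilinearGenerator {i, j, k} g) (hg : g ∈ J) :
    ∃ B : Basis (Fin 4) K (Fin 4 → K),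
      B 1 = D.focus i ∧ B 2 = D.focus j ∧ B 3 = D.focus k ∧
      D.trilinear i j k (B.coord 1) (B.coord 2) (B.coord 3) ∈ J := by
  let P : Fin n → Fin n → Fin n → Prop := fun i j k => ∃ B : Basis (Fin 4) K (Fin 4 → K),
      B 1 = D.focus i ∧ B 2 = D.focus j ∧ B 3 = D.focus k ∧
      D.trilinear i j k (B.coord 1) (B.coord 2) (B.coord 3) ∈ J
  have hco : ∀ (B : Basis (Fin 4) K (Fin 4 → K)) (e : Fin 4 ≃ Fin 4) d,
      (B.reindex e).coord d = B.coord (e.symm d) := by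
    intro B e d
    ext x
    simp
  have s12 : ∀ i j k, P i j k → P j i k := by
    rintro i j k ⟨B, h1, h2, h3, h⟩
    refine ⟨B.reindex (Equiv.swap 1 2), ?_, ?_, ?_, ?_⟩
    · simpa using h2
    · simpa using h1
    · simpa [Equiv.swap_apply_def] using h3
    · simp only [hco, Equiv.symm_swap]
      have : D.trilinear j i k (B.coord 2) (B.coord 1) (B.coord 3) =
          -D.trilinear i j k (B.coord 1) (B.coord 2) (B.coord 3) := by
        simp only [trilinear]; ring
      rw [show (Equiv.swap (1 : Fin 4) 2) 1 = 2 from rfl,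
        show (Equiv.swap (1 : Fin 4) 2) 2 = 1 from rfl,
        show (Equiv.swap (1 : Fin 4) 2) 3 = 3 from rfl, this]
      exact J.neg_mem h
  have s23 : ∀ i j k, P i j k → P i k j := by
    rintro i j k ⟨B, h1, h2, h3, h⟩
    refine ⟨B.reindex (Equiv.swap 2 3), ?_, ?_, ?_, ?_⟩
    · simpa [Equiv.swap_apply_def] using h1
    · simpa using h3
    · simpa using h2
    · simp only [hco, Equiv.symm_swap]
      have : D.trilinear i k j (B.coord 1) (B.coord 3) (B.coord 2) =
          -D.trilinear i j k (B.coord 1) (B.coord 2) (B.coord 3) := by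
        simp only [trilinear]; ring
      rw [show (Equiv.swap (2 : Fin 4) 3) 1 = 1 from rfl,
        show (Equiv.swap (2 : Fin 4) 3) 2 = 3 from rfl,
        show (Equiv.swap (2 : Fin 4) 3) 3 = 2 from rfl, this]
      exact J.neg_mem h
  obtain ⟨i', j', k', hij', hik', hjk', hσ, B, h1, h2, h3, rfl⟩ := h
  have hP : P i' j' k' := ⟨B, h1, h2, h3, hg⟩
  have hi : i ∈ ({i', j', k'} : Finset (Fin n)) := hσ ▸ by simp
  have hj : j ∈ ({i', j', k'} : Finset (Fin n)) := hσ ▸ by simp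
  have hk : k ∈ ({i', j', k'} : Finset (Fin n)) := hσ ▸ by simp
  change P i j k
  clear_value P
  simp only [Finset.mem_insert, Finset.mem_singleton] at hi hj hk
  rcases hi with rfl | rfl | rfl <;> rcases hj with rfl | rfl | rfl <;>
    rcases hk with rfl | rfl | rfl <;>
    first
    | exact absurd rfl hij
    | exact absurd rfl hik
    | exact absurd rfl hjk
    | exact hP
    | exact s12 _ _ _ hP
    | exact s23 _ _ _ hP
    | exact s12 _ _ _ (s23 _ _ _ hP)
    | exact s23 _ _ _ (s12 _ _ _ hP)
    | exact s12 _ _ _ (s23 _ _ _ (s12 _ _ _ hP))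

-- The span is a multihomogeneous ideal, so membership can be tested on components, where the
-- induction on the degree applies.
attribute [local instance] MvPolynomial.weightedGradedAlgebra in
variable (D) in
theorem span_generators_eq_multiviewIdeal [Infinite K] (hn : 0 < n)
    (hA : LinearlyGeneralPosition A) (g : Finset (Fin n) → CoordRing K n)
    (h2 : ∀ σ, σ.card = 2 → D.IsBilinearGenerator σ (g σ))
    (h3 : ∀ σ, σ.card = 3 → D.IsTrilinearGenerator σ (g σ)) :
    Ideal.span (g '' {σ | σ.card = 2 ∨ σ.card = 3}) = multiviewIdeal A := by
  classical
  set J := Ideal.span (g '' {σ | σ.card = 2 ∨ σ.card = 3}) with hJ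
  have hlin : ∀ σ : Finset (Fin n), σ.card = 2 ∨ σ.card = 3 →
      IsMultilinear (g σ) σ ∧ pullback A (g σ) = 0 := fun σ h => h.elim
    (fun h => ⟨(h2 σ h).isMultilinear, (h2 σ h).pullback_eq_zero⟩)
    (fun h => ⟨(h3 σ h).isMultilinear, (h3 σ h).pullback_eq_zero⟩)
  apply le_antisymm
  · rw [hJ, Ideal.span_le]
    rintro _ ⟨σ, hσ, rfl⟩
    exact mem_multiviewIdeal_of_pullback_eq_zero (hlin σ hσ).1 (hlin σ hσ).2
  · intro f hf
    rw [D.mem_multiviewIdeal_iff hn] at hf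
    have hhom : J.IsHomogeneous (MvPolynomial.weightedHomogeneousSubmodule K weights) := by
      apply Ideal.homogeneous_span
      rintro _ ⟨σ, hσ, rfl⟩
      exact ⟨_, isMultihomogeneous_iff.1 (hlin σ hσ).1⟩
    rw [MvPolynomial.mem_iff_weightedHomogeneousComponent_mem K weights hhom]
    intro u
    refine D.mem_of_pullback_eq_zero hA
      (fun f hf u => MvPolynomial.weightedHomogeneousComponent_mem_of_mem K weights hhom hf u)
      ?_ ?_ ?_ (MvPolynomial.weightedHomogeneousComponent_isWeightedHomogeneous u f) (hf u)
    · have : J ≤ RingHom.ker (pullback A) := by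
        rw [hJ, Ideal.span_le]
        rintro _ ⟨σ, hσ, rfl⟩
        exact (hlin σ hσ).2
      exact fun f hf => this hf
    · intro i j hij α β
      have hc : ({i, j} : Finset (Fin n)).card = 2 := Finset.card_pair hij
      have hmem : g {i, j} ∈ J := Ideal.subset_span ⟨_, Or.inl hc, rfl⟩
      exact (h2 _ hc).bilinear_mem hmem
    · intro i j k hij hik hjk
      have hc : ({i, j, k} : Finset (Fin n)).card = 3 :=
        Finset.card_eq_three.2 ⟨i, j, k, hij, hik, hjk, rfl⟩
      have hmem : g {i, j, k} ∈ J := Ideal.subset_span ⟨_, Or.inr hc, rfl⟩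
      exact (h3 _ hc).exists_trilinear_mem hij hik hjk hmem

end Frame

end Multiview

/-! ### The minimal generating set -/

open Classical in
theorem corollary2p6 {K : Type*} [Field K] [IsAlgClosed K] (n : ℕ) (hn : 2 ≤ n)
    (A : Fin n → Matrix (Fin 3) (Fin 4) K) (hrank : ∀ i, (A i).rank = 3)
    (hA : Multiview.LinearlyGeneralPosition A) :
    ∃ B T : Finset (Multiview.CoordRing K n),
      B.card = n.choose 2 ∧ (∀ f ∈ B, Multiview.IsBilinear f) ∧
      T.card = n.choose 3 ∧ (∀ f ∈ T, Multiview.IsTrilinear f) ∧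
      Disjoint B T ∧
      Multiview.MinimallyGenerates (B ∪ T) (Multiview.multiviewIdeal A) := by
  have : Infinite K := IsAlgClosed.instInfinite
  obtain ⟨D⟩ := Multiview.nonempty_frame hrank
  obtain ⟨g, h2, h3⟩ : ∃ g : Finset (Fin n) → Multiview.CoordRing K n,
      (∀ σ, σ.card = 2 → D.IsBilinearGenerator σ (g σ)) ∧
      (∀ σ, σ.card = 3 → D.IsTrilinearGenerator σ (g σ)) := by
    choose g2 h2 using fun (σ : Finset (Fin n)) (h : σ.card = 2) => D.exists_isBilinearGenerator hA h
    choose g3 h3 using fun (σ : Finset (Fin n)) (h : σ.card = 3) => D.exists_isTrilinearGenerator hA h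
    refine ⟨fun σ => if h : σ.card = 2 then g2 σ h else if h : σ.card = 3 then g3 σ h else 0,
      fun σ h => ?_, fun σ h => ?_⟩
    · simpa [h] using h2 σ h
    · have h' : σ.card ≠ 2 := by omega
      simpa [h, h'] using h3 σ h
  let I2 : Finset (Finset (Fin n)) := Finset.univ.powersetCard 2
  let I3 : Finset (Finset (Fin n)) := Finset.univ.powersetCard 3
  have hI2 : ∀ σ, σ ∈ I2 ↔ σ.card = 2 := by simp [I2, Finset.mem_powersetCard]
  have hI3 : ∀ σ, σ ∈ I3 ↔ σ.card = 3 := by simp [I3, Finset.mem_powersetCard]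
  have hI : ∀ σ, σ ∈ I2 ∪ I3 ↔ σ.card = 2 ∨ σ.card = 3 := by
    intro σ; rw [Finset.mem_union, hI2, hI3]
  have hgen : ∀ σ ∈ I2 ∪ I3, D.IsGenerator σ (g σ) := fun σ hσ =>
    ((hI σ).1 hσ).elim (fun h => Or.inl (h2 σ h)) fun h => Or.inr (h3 σ h)
  have hsep : ∀ σ : Finset (Fin n), ∃ (v : Fin n → Fin 4 → K) (d : ℕ), σ ∈ I2 ∪ I3 →
      Multiview.slice A v (g σ) = Polynomial.X ^ d ∧
      ∀ τ g', D.IsGenerator τ g' → τ ≠ σ → Multiview.slice A v g' = 0 := by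
    intro σ
    by_cases h : σ ∈ I2 ∪ I3
    · obtain ⟨v, d, hv⟩ := (hgen σ h).exists_separating_slice
      exact ⟨v, d, fun _ => hv⟩
    · exact ⟨0, 0, fun h' => absurd h' h⟩
  choose v d hv using hsep
  -- Separation gives distinctness: a generator shared by two index sets would be both zero and a
  -- power of the variable on one curve. This yields the exact cardinalities and the disjointness.
  have hinj : ∀ σ ∈ I2 ∪ I3, ∀ τ ∈ I2 ∪ I3, g σ = g τ → σ = τ := by
    intro σ hσ τ hτ e
    by_contra hne
    have h1 := (hv σ hσ).1
    rw [e, (hv σ hσ).2 τ _ (hgen τ hτ) (Ne.symm hne)] at h1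
    exact pow_ne_zero _ Polynomial.X_ne_zero h1.symm
  have hI23 : Disjoint I2 I3 := by
    rw [Finset.disjoint_left]
    intro σ h h'
    rw [hI2] at h
    rw [hI3] at h'
    omega
  have hunion : I2.image g ∪ I3.image g = (I2 ∪ I3).image g := (Finset.image_union I2 I3).symm
  have hspan : Ideal.span (((I2 ∪ I3).image g : Finset (Multiview.CoordRing K n)) :
      Set (Multiview.CoordRing K n)) = Multiview.multiviewIdeal A := by
    rw [← D.span_generators_eq_multiviewIdeal (by omega) hA g h2 h3, Finset.coe_image]
    congr 2
    ext σ
    exact hI σ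
  have hle : ∀ H : Finset (Multiview.CoordRing K n),
      Ideal.span (H : Set (Multiview.CoordRing K n)) = Multiview.multiviewIdeal A →
      ((I2 ∪ I3).image g).card ≤ H.card := by
    intro H hH
    refine Finset.card_image_le.trans (Multiview.card_le_of_separating (I2 ∪ I3) g
      (fun σ => Multiview.slice A (v σ)) d (fun σ _ h => Multiview.coeff_zero_slice A (v σ) h)
      (fun σ hσ => (hv σ hσ).1) (fun σ hσ τ hτ hne => (hv σ hσ).2 τ _ (hgen τ hτ) hne) H ?_)
    rw [hH, ← hspan, Finset.coe_image]
  refine ⟨I2.image g, I3.image g, ?_, ?_, ?_, ?_, ?_, ?_⟩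
  · rw [Finset.card_image_of_injOn fun σ hσ τ hτ e => hinj σ (Finset.mem_union_left _ hσ) τ
      (Finset.mem_union_left _ hτ) e, Finset.card_powersetCard, Finset.card_univ, Fintype.card_fin]
  · intro f hf
    obtain ⟨σ, hσ, rfl⟩ := Finset.mem_image.1 hf
    exact ⟨σ, (hI2 σ).1 hσ, (h2 σ ((hI2 σ).1 hσ)).isMultilinear⟩
  · rw [Finset.card_image_of_injOn fun σ hσ τ hτ e => hinj σ (Finset.mem_union_right _ hσ) τ
      (Finset.mem_union_right _ hτ) e, Finset.card_powersetCard, Finset.card_univ, Fintype.card_fin]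
  · intro f hf
    obtain ⟨σ, hσ, rfl⟩ := Finset.mem_image.1 hf
    exact ⟨σ, (hI3 σ).1 hσ, (h3 σ ((hI3 σ).1 hσ)).isMultilinear⟩
  · rw [Finset.disjoint_left]
    intro f hf hf'
    obtain ⟨σ, hσ, rfl⟩ := Finset.mem_image.1 hf
    obtain ⟨τ, hτ, e⟩ := Finset.mem_image.1 hf'
    have := hinj τ (Finset.mem_union_right _ hτ) σ (Finset.mem_union_left _ hσ) e
    subst this
    exact Finset.disjoint_left.1 hI23 hσ hτ
  · rw [hunion]
    exact ⟨hspan, fun H hH e => absurd (hle H e) (not_le.2 (Finset.card_lt_card hH)), hle⟩
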